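/- Let $d$ be a prime, $\omega=e^{2\pi i/d}$, and let $\mathcal U$ be the group of unitary operators on $\mathbb C^d$ with computational basis $|z\rangle$, $z\in\mathbb Z_d$. Put $Z|z\rangle=\omega^z|z\rangle$, $X|z\rangle=|z+1\rangle$, let $\tau=\omega$ if $d$ is odd and $\tau=i$ if $d=2$, and let $\mathcal C_1=\{\tau^cZ^pX^q : c,p,q\in\mathbb Z_{\ge 0}\}$ be the Pauli group. The levels of the Clifford hierarchy are defined by $\mathcal C_k=\{G\in\mathcal U : G\,\mathcal C_1G^*\subseteq\mathcal C_{k-1}\}$ for $k\ge 2$; $\mathcal C_2$ is the group of Clifford gates. Let $\mathcal D_k$ be the set of diagonal gates $D\in\mathcal C_k$ with $D|0\rangle=|0\rangle$. Let $H$ be the Hadamard gate, $H_{ij}=d^{-1/2}\omega^{ij}$; let $E|z\rangle=\omega^{z^2}|z\rangle$ if $d$ is odd and $E=\mathrm{diag}(1,i)$ if $d=2$; and let $\mathcal M=\{I\}\cup\{E^cH : c=0,\dots,d-1\}$. Theorem (Normal Form for Semi-Clifford Gates). Let $k\ge 2$ and let $R\subseteq\mathcal D_k$ be a set containing exactly one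 element of each coset of $\mathcal D_2$ in $\mathcal D_k$, with $I\in R$. Then: 1. every gate $G\in\mathcal C_k$ with $G\notin\mathcal C_2$ can be written as $G=MDC$ for exactly one triple $(M,D,C)$ with $M\in\mathcal M$, $D\in R\setminus\{I\}$ and $C\in\mathcal C_2$; 2. conversely, $\mathcal C_2\subseteq\mathcal C_k$, and for all $M\in\mathcal M$, $D\in R\setminus\{I\}$ and $C\in\mathcal C_2$ the product $MDC$ belongs to $\mathcal C_k$ and not to $\mathcal C_2$. Thus every gate in $\mathcal C_k$ is either a Clifford gate or, uniquely, of the form $MDC$, these two cases exclude each other, and these gates are exactly the gates in $\mathcal C_k$. -/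

import Mathlib

open Matrix

noncomputable section

namespace CliffordHierarchy

/-- The group `𝒰` of unitary gates on `ℂ^d`, the computational basis being indexed by `ℤ/d`. -/
abbrev Gate (d : ℕ) [NeZero d] : Type := Matrix.unitaryGroup (ZMod d) ℂ

theorem diagonal_mem_unitary (d : ℕ) [NeZero d] (f : ZMod d → ℂ) (hf : ∀ z, f z * star (f z) = 1) :
    Matrix.diagonal f ∈ Matrix.unitaryGroup (ZMod d) ℂ := by
  rw [Matrix.mem_unitaryGroup_iff, Matrix.star_eq_conjTranspose, Matrix.diagonal_conjTranspose,
    Matrix.diagonal_mul_diagonal]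
  rw [← Matrix.diagonal_one]
  congr 1
  funext z
  exact hf z

theorem stdAddChar_mul_star (d : ℕ) [NeZero d] (z : ZMod d) :
    ZMod.stdAddChar z * star (ZMod.stdAddChar z : ℂ) = 1 := by
  rw [Complex.star_def, Complex.mul_conj, Complex.normSq_eq_norm_sq]
  simp

/-- `Z |z⟩ = ω ^ z |z⟩`, where `ZMod.stdAddChar z = ω ^ z` and `ω = exp (2 π i / d)`. -/
def pauliZ (d : ℕ) [NeZero d] : Gate d :=
  ⟨Matrix.diagonal fun z => ZMod.stdAddChar z,
    diagonal_mem_unitary d _ (stdAddChar_mul_star d)⟩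

theorem shift_mem_unitary (d : ℕ) [NeZero d] :
    (Matrix.of fun i j : ZMod d => if i = j + 1 then (1 : ℂ) else 0) ∈
      Matrix.unitaryGroup (ZMod d) ℂ := by
  rw [Matrix.mem_unitaryGroup_iff']
  ext i j
  simp [Matrix.mul_apply, Matrix.star_apply, Matrix.one_apply, eq_comm]

/-- `X |z⟩ = |z + 1⟩`. -/
def pauliX (d : ℕ) [NeZero d] : Gate d :=
  ⟨Matrix.of fun i j => if i = j + 1 then 1 else 0, shift_mem_unitary d⟩

theorem fourier_mem_unitary (d : ℕ) [NeZero d] :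
    (Matrix.of fun i j : ZMod d => ((Real.sqrt d : ℝ) : ℂ)⁻¹ * ZMod.stdAddChar (i * j)) ∈
      Matrix.unitaryGroup (ZMod d) ℂ := by
  rw [Matrix.mem_unitaryGroup_iff]
  ext i j
  have hd : (d : ℂ) ≠ 0 := Nat.cast_ne_zero.mpr (NeZero.ne d)
  have hs : ((Real.sqrt d : ℝ) : ℂ)⁻¹ * ((Real.sqrt d : ℝ) : ℂ)⁻¹ = (d : ℂ)⁻¹ := by
    rw [← mul_inv, ← Complex.ofReal_mul, Real.mul_self_sqrt (Nat.cast_nonneg d)]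
    simp
  have key : ∀ x : ZMod d,
      ((Real.sqrt d : ℝ) : ℂ)⁻¹ * ZMod.stdAddChar (i * x) *
        star (((Real.sqrt d : ℝ) : ℂ)⁻¹ * ZMod.stdAddChar (j * x)) =
      (d : ℂ)⁻¹ * ZMod.stdAddChar (x * (i - j)) := by
    intro x
    have h1 : star (ZMod.stdAddChar (j * x) : ℂ) = ZMod.stdAddChar (-(j * x)) := by
      rw [AddChar.map_neg_eq_conj]; rfl
    have h2 : star (((Real.sqrt d : ℝ) : ℂ)⁻¹) = ((Real.sqrt d : ℝ) : ℂ)⁻¹ := by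
      rw [star_inv₀, Complex.star_def, Complex.conj_ofReal]
    rw [star_mul, h1, h2, ← hs, show x * (i - j) = i * x + -(j * x) by ring,
      AddChar.map_add_eq_mul]
    ring
  rw [Matrix.mul_apply]
  simp only [Matrix.star_apply, Matrix.of_apply, key]
  rw [← Finset.mul_sum, AddChar.sum_mulShift _ (ZMod.isPrimitive_stdAddChar d), ZMod.card,
    Matrix.one_apply]
  by_cases h : i = j
  · simp [h, hd]
  · simp [h, sub_eq_zero]

/-- The Hadamard gate, `H i j = d ^ (-1/2) * ω ^ (i j)`. -/
def hadamard (d : ℕ) [NeZero d] : Gate d :=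
  ⟨Matrix.of fun i j => ((Real.sqrt d : ℝ) : ℂ)⁻¹ * ZMod.stdAddChar (i * j),
    fourier_mem_unitary d⟩

/-- For qubits this is the phase gate `S = diag (1, i)`; for odd `d` it is the diagonal gate
`E |z⟩ = ω ^ (z ^ 2) |z⟩`. -/
def gateE (d : ℕ) [NeZero d] : Gate d :=
  ⟨Matrix.diagonal fun z => if d = 2 then Complex.I ^ z.val else ZMod.stdAddChar (z ^ 2),
    diagonal_mem_unitary d _ (by
      intro z
      split_ifs
      · rw [star_pow, ← mul_pow]
        simp
      · exact stdAddChar_mul_star d _)⟩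

/-- The generator of the scalars in the Pauli group: `ω = exp (2 π i / d)` for odd `d`, and the
imaginary unit for qubits. -/
def pauliPhase (d : ℕ) : ℂ :=
  if d = 2 then Complex.I else Complex.exp (2 * Real.pi * Complex.I / d)

/-- The Pauli gates `𝒞₁`: all products of a power of `pauliPhase d`, a power of `Z` and
a power of `X`. -/
def pauliGates (d : ℕ) [NeZero d] : Set (Gate d) :=
  {U | ∃ c p q : ℕ, (U : Matrix (ZMod d) (ZMod d) ℂ) =
    pauliPhase d ^ c • ((pauliZ d ^ p * pauliX d ^ q : Gate d) : Matrix (ZMod d) (ZMod d) ℂ)}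

/-- The levels `𝒞ₖ` of the Clifford hierarchy, `k ≥ 1`: `𝒞₁` is the Pauli group and
`𝒞ₖ₊₁ = {G | G 𝒞₁ G* ⊆ 𝒞ₖ}`; `𝒞₂` is the Clifford group. (There is no level `0`.) -/
def level (d : ℕ) [NeZero d] : ℕ → Set (Gate d)
  | 0 => ∅
  | 1 => pauliGates d
  | k + 2 => {G | ∀ P ∈ pauliGates d, G * P * G⁻¹ ∈ level d (k + 1)}

/-- The phaseless diagonal gates `𝒟ₖ` of level `k`: the diagonal `D ∈ 𝒞ₖ` with `D |0⟩ = |0⟩`. -/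
def diagLevel (d : ℕ) [NeZero d] (k : ℕ) : Set (Gate d) :=
  {D | D ∈ level d k ∧ (D : Matrix (ZMod d) (ZMod d) ℂ).IsDiag ∧
    (D : Matrix (ZMod d) (ZMod d) ℂ) 0 0 = 1}

/-- `R` consists of exactly one element of each coset `D 𝒟₂` of `𝒟₂` in `𝒟ₖ`. -/
def IsCosetRepresentatives (d : ℕ) [NeZero d] (k : ℕ) (R : Set (Gate d)) : Prop :=
  R ⊆ diagLevel d k ∧ ∀ D ∈ diagLevel d k, ∃! r, r ∈ R ∧ r⁻¹ * D ∈ diagLevel d 2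

/-- The set `ℳ = {I} ∪ {E ^ c H | c = 0, …, d - 1}`. -/
def gatesM (d : ℕ) [NeZero d] : Set (Gate d) :=
  {1} ∪ {M | ∃ c : ℕ, c < d ∧ M = gateE d ^ c * hadamard d}

end CliffordHierarchy

end

/-!
# The normal form of gates in the Clifford hierarchy of one qudit

Let `N` (`projPauli`) be the group of Pauli gates with arbitrary scalars and `S` the center of the
unitary group, which consists of the scalars. Modulo `S`, the group `N` is a plane over `ℤ/d`, on
which commutators define a nondegenerate symplectic form; two elements of `N` span this plane
exactly when they do not commute. These properties are recorded in `IsHeisenberg`, and the main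
part of the argument uses nothing else. Its basic tool is that a group element which commutes
modulo `S` with two non-commuting elements of `N` lies in `N` (`IsHeisenberg.mem_of_commute_mk`).
The Clifford gates are the normalizer of `N` (`mem_level_two_iff`).

The key fact is that every gate `G` of the hierarchy is semi-Clifford: it conjugates some
noncentral element of `N` into `N` (`exists_pauli_conj_mem`). This is proved by induction on the
level. If `G` has level `k + 1`, where `k ≥ 2`, then the gates `A = G n G⁻¹`, `n ∈ N`, and their
powers have level `k`, so they are semi-Clifford. Since `A ^ d` is a scalar, and `A` and `A ^ 2`
are semi-Clifford, `A` commutes modulo `S` with a noncentral element of `N`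
(`IsHeisenberg.exists_commute_mk`). Applying this to the images `A` and `B` of two non-commuting
elements of `N` and to the product `A B`, one finds that `G` is semi-Clifford as well
(`IsHeisenberg.exists_conj_mem`).

Now let `G u G⁻¹` be a Pauli gate, with `u` a nontrivial Pauli gate. The gates `M ∈ ℳ` are Clifford
gates, and the Pauli gates `M Z M⁻¹` represent each of the `d + 1` lines of the plane exactly once
(`exists_gatesM_conj`, `eq_of_commute_conj`). Let `M` and `M'` belong to the lines of `G u G⁻¹` and
of `u`. Then `M⁻¹ G M'` conjugates the line of `Z` to itself, and a Clifford factor on the right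
makes it commute with `Z`, that is, diagonal. This gives `G = M D C`. If `G` is not a Clifford
gate, then `M Z M⁻¹` spans the only line of Pauli gates which `G⁻¹` conjugates to Pauli gates, so
`G` determines `M`; and then it determines the coset of `D`, hence `D ∈ R`, and `C`.
-/

open scoped commutatorElement

noncomputable section

namespace CliffordHierarchy

/-! ### Commutators modulo the center -/

section Heisenberg

variable {Γ : Type*} [Group Γ]

/-- The quotient map of a group modulo its center. -/
abbrev modCenter : Γ →* Γ ⧸ Subgroup.center Γ := QuotientGroup.mk' (Subgroup.center Γ)

/-- A subgroup `N` of `Γ` behaves like a Heisenberg group of order `p ^ 3` enlarged by the center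
of `Γ`: modulo the center it is abelian of exponent `p`, only central elements of `Γ` commute with
two non-commuting elements of `N`, and every nontrivial `p`-torsion element of the center generates
the `p`-torsion of the center. Commuting modulo the center is expressed through `modCenter`. -/
structure IsHeisenberg (p : ℕ) (N : Subgroup Γ) : Prop where
  center_le : Subgroup.center Γ ≤ N
  commute_mk : ∀ a ∈ N, ∀ b ∈ N, Commute (modCenter a) (modCenter b)
  pow_mem : ∀ a ∈ N, a ^ p ∈ Subgroup.center Γ
  mem_center : ∀ a ∈ N, ∀ b ∈ N, ¬ Commute a b → ∀ g, Commute g a → Commute g b →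
    g ∈ Subgroup.center Γ
  exists_zpow_eq : ∀ y ∈ Subgroup.center Γ, ∀ z ∈ Subgroup.center Γ, y ^ p = 1 → z ^ p = 1 →
    y ≠ 1 → ∃ i : ℤ, y ^ i = z
  exists_not_commute : ∃ a ∈ N, ∃ b ∈ N, ¬ Commute a b

theorem commute_mk_iff {g a : Γ} : Commute (modCenter g) (modCenter a) ↔
    ⁅g, a⁆ ∈ Subgroup.center Γ := by
  rw [← commutatorElement_eq_one_iff_commute, ← map_commutatorElement, ← MonoidHom.mem_ker,
    QuotientGroup.ker_mk']

theorem mk_eq_one_iff {g : Γ} : modCenter g = 1 ↔ g ∈ Subgroup.center Γ := by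
  rw [← MonoidHom.mem_ker, QuotientGroup.ker_mk']

theorem mk_eq_mk_iff {g h : Γ} : modCenter g = modCenter h ↔
    ∃ s ∈ Subgroup.center Γ, g = s * h := by
  rw [← mul_inv_eq_one, ← map_inv, ← map_mul, mk_eq_one_iff]
  constructor
  · exact fun H => ⟨_, H, by group⟩
  · rintro ⟨s, hs, rfl⟩
    simpa using hs

theorem commutator_mul_left {g h a : Γ} (H : Commute (modCenter h) (modCenter a)) :
    ⁅g * h, a⁆ = ⁅g, a⁆ * ⁅h, a⁆ := by
  have hc := Subgroup.mem_center_iff.1 (commute_mk_iff.1 H)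
  calc ⁅g * h, a⁆ = g * ⁅h, a⁆ * g⁻¹ * ⁅g, a⁆ := by simp only [commutatorElement_def]; group
    _ = ⁅g, a⁆ * ⁅h, a⁆ := by rw [hc g, mul_inv_cancel_right, hc]

theorem commutator_inv_left {g a : Γ} (H : Commute (modCenter g) (modCenter a)) :
    ⁅g⁻¹, a⁆ = ⁅g, a⁆⁻¹ := by
  rw [eq_inv_iff_mul_eq_one, ← commutator_mul_left H]
  simp

theorem commutator_pow_left {g a : Γ} (H : Commute (modCenter g) (modCenter a)) (n : ℕ) :
    ⁅g ^ n, a⁆ = ⁅g, a⁆ ^ n := by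
  induction n with
  | zero => simp
  | succ n ih => rw [pow_succ, commutator_mul_left H, ih, pow_succ]

theorem commutator_zpow_left {g a : Γ} (H : Commute (modCenter g) (modCenter a)) (n : ℤ) :
    ⁅g ^ n, a⁆ = ⁅g, a⁆ ^ n := by
  cases n with
  | ofNat n => simpa using commutator_pow_left H n
  | negSucc n =>
    rw [zpow_negSucc, zpow_negSucc, commutator_inv_left, commutator_pow_left H]
    rw [map_pow]
    exact H.pow_left _

theorem commutator_pow_eq_one {g a : Γ} {p : ℕ} (H : Commute (modCenter g) (modCenter a))
    (ha : a ^ p ∈ Subgroup.center Γ) : ⁅g, a⁆ ^ p = 1 := by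
  rw [← _root_.inv_inj, inv_one, ← inv_pow, commutatorElement_inv, ← commutator_pow_left H.symm,
    commutatorElement_eq_one_iff_commute]
  exact (Subgroup.mem_center_iff.1 ha g).symm

/-- On the centralizer of `e` modulo the center, `g ↦ ⁅g, e⁆` is a homomorphism to an abelian group,
so it kills commutators. -/
theorem commute_commutator {g h e : Γ} (hg : Commute (modCenter g) (modCenter e))
    (hh : Commute (modCenter h) (modCenter e)) : Commute ⁅g, h⁆ e := by
  have hgi : Commute (modCenter g⁻¹) (modCenter e) := by rw [map_inv]; exact hg.inv_left
  have hhi : Commute (modCenter h⁻¹) (modCenter e) := by rw [map_inv]; exact hh.inv_left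
  rw [← commutatorElement_eq_one_iff_commute, commutatorElement_def g h, commutator_mul_left hhi,
    commutator_mul_left hgi, commutator_mul_left hh, commutator_inv_left hg,
    commutator_inv_left hh,
    ← Subgroup.mem_center_iff.1 (commute_mk_iff.1 hg) ⁅h, e⁆]
  group

theorem commute_mk_conj {g h A : Γ} (H : Commute (modCenter g) (modCenter h)) :
    Commute (modCenter (A * g * A⁻¹)) (modCenter (A * h * A⁻¹)) := by
  simp only [map_mul, map_inv]
  exact H.conj _

theorem not_mem_center_conj {g A : Γ} (H : g ∉ Subgroup.center Γ) :
    A * g * A⁻¹ ∉ Subgroup.center Γ := by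
  intro h
  apply H
  have := (inferInstance : (Subgroup.center Γ).Normal).conj_mem _ h A⁻¹
  convert this using 1
  group

/-! ### Fixed points of elements of order `p` -/

/-- If `a ^ p = 1` and `a` normalizes a nontrivial finite `p`-group `V`, then `a` commutes with a
nontrivial element of `V`: the number of fixed points of `a` on `V` is divisible by `p`. -/
theorem exists_commute_of_normalizes {Q : Type*} [Group Q] {p : ℕ} [Fact p.Prime] (V : Subgroup Q)
    [Finite V] (hV : IsPGroup p V) (hV1 : V ≠ ⊥) (a : Q) (ha : a ^ p = 1)
    (haV : ∀ v ∈ V, a * v * a⁻¹ ∈ V) : ∃ v ∈ V, v ≠ 1 ∧ Commute a v := by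
  classical
  have := Fintype.ofFinite V
  let f : Function.End V := fun v => ⟨a * v * a⁻¹, haV v v.2⟩
  have hf : ∀ n : ℕ, ∀ v : V, (((f ^ n) v : V) : Q) = a ^ n * v * (a ^ n)⁻¹ := by
    intro n
    induction n with
    | zero => 
      intro v
      show (v : Q) = a ^ 0 * v * (a ^ 0)⁻¹
      simp
    | succ n ih =>
      intro v
      rw [pow_succ]
      show (((f ^ n) (f v) : V) : Q) = _
      rw [ih, pow_succ]
      show a ^ n * (a * v * a⁻¹) * (a ^ n)⁻¹ = _
      group
  have hf1 : f ^ p ^ 1 = 1 := by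
    funext v
    apply Subtype.ext
    rw [hf, pow_one, ha]
    show 1 * (v : Q) * 1⁻¹ = v
    simp
  have hcard := Equiv.Perm.card_fixedPoints_modEq hf1
  have hdvd : p ∣ Fintype.card V := by
    have : Nontrivial V := (Subgroup.nontrivial_iff_ne_bot V).2 hV1
    obtain ⟨n, hn, h⟩ := hV.nontrivial_iff_card.1 this
    rw [← Nat.card_eq_fintype_card, h]
    exact dvd_pow_self p hn.ne'
  have hdvd' : p ∣ Fintype.card (Function.fixedPoints f) :=
    (Nat.modEq_zero_iff_dvd.1 (hcard.symm.trans (Nat.modEq_zero_iff_dvd.2 hdvd)))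
  have h1 : (1 : V) ∈ Function.fixedPoints f := by
    apply Subtype.ext
    simp [f]
  have hpos : 0 < Fintype.card (Function.fixedPoints f) := Fintype.card_pos_iff.2 ⟨⟨1, h1⟩⟩
  have hlt : 1 < Fintype.card (Function.fixedPoints f) :=
    lt_of_lt_of_le (Fact.out : p.Prime).one_lt (Nat.le_of_dvd hpos hdvd')
  obtain ⟨⟨v, hv⟩, hne⟩ := Fintype.exists_ne_of_one_lt_card hlt ⟨1, h1⟩
  refine ⟨v, v.2, fun h => hne (Subtype.ext (Subtype.ext h)), ?_⟩
  have := congrArg Subtype.val hv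
  simp only [f] at this
  rw [mul_inv_eq_iff_eq_mul] at this
  exact this

/-! ### Heisenberg groups and semi-Clifford elements -/

namespace IsHeisenberg

variable {p : ℕ} {N : Subgroup Γ}

/-- Given non-commuting `a, b ∈ N`, an element commuting with both modulo the center can be
corrected by a product of powers of `a` and `b` so as to commute with both exactly, and is therefore
central. -/
theorem exists_eq_mul_zpow (hN : IsHeisenberg p N) {a b g : Γ} (ha : a ∈ N) (hb : b ∈ N)
    (hab : ¬ Commute a b) (hga : Commute (modCenter g) (modCenter a))
    (hgb : Commute (modCenter g) (modCenter b)) :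
    ∃ s ∈ Subgroup.center Γ, ∃ i j : ℤ, g = s * (a ^ i * b ^ j) := by
  have hba := hN.commute_mk b hb a ha
  have hab' : ⁅a, b⁆ ≠ 1 := fun h => hab (commutatorElement_eq_one_iff_commute.1 h)
  have hba' : ⁅b, a⁆ ≠ 1 := fun h => hab (commutatorElement_eq_one_iff_commute.1 h).symm
  obtain ⟨j, hj⟩ := hN.exists_zpow_eq ⁅b, a⁆ (commute_mk_iff.1 hba) ⁅g, a⁆ (commute_mk_iff.1 hga)
    (commutator_pow_eq_one hba (hN.pow_mem a ha)) (commutator_pow_eq_one hga (hN.pow_mem a ha)) hba'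
  obtain ⟨i, hi⟩ := hN.exists_zpow_eq ⁅a, b⁆ (commute_mk_iff.1 hba.symm) ⁅g, b⁆
    (commute_mk_iff.1 hgb) (commutator_pow_eq_one hba.symm (hN.pow_mem b hb))
    (commutator_pow_eq_one hgb (hN.pow_mem b hb)) hab'
  have hwN : a ^ i * b ^ j ∈ N := N.mul_mem (N.zpow_mem ha i) (N.zpow_mem hb j)
  refine ⟨g * (a ^ i * b ^ j)⁻¹, ?_, i, j, by group⟩
  have key : ∀ c ∈ N, ⁅g, c⁆ = ⁅a ^ i * b ^ j, c⁆ → Commute (g * (a ^ i * b ^ j)⁻¹) c := by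
    intro c hc h
    have hwc := hN.commute_mk _ hwN c hc
    rw [← commutatorElement_eq_one_iff_commute, commutator_mul_left, commutator_inv_left hwc, h,
      mul_inv_cancel]
    rw [map_inv]
    exact hwc.inv_left
  apply hN.mem_center a ha b hb hab
  · apply key a ha
    rw [commutator_mul_left (hN.commute_mk _ (N.zpow_mem hb j) a ha),
      commutatorElement_eq_one_iff_commute.2 ((Commute.refl a).zpow_left i), one_mul,
      commutator_zpow_left hba, hj]
  · apply key b hb
    rw [commutator_mul_left (hN.commute_mk _ (N.zpow_mem hb j) b hb),
      commutatorElement_eq_one_iff_commute.2 ((Commute.refl b).zpow_left j), mul_one,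
      commutator_zpow_left hba.symm, hi]

theorem mem_of_commute_mk (hN : IsHeisenberg p N) {a b g : Γ} (ha : a ∈ N) (hb : b ∈ N)
    (hab : ¬ Commute a b) (hga : Commute (modCenter g) (modCenter a))
    (hgb : Commute (modCenter g) (modCenter b)) : g ∈ N := by
  obtain ⟨s, hs, i, j, rfl⟩ := hN.exists_eq_mul_zpow ha hb hab hga hgb
  exact N.mul_mem (hN.center_le hs) (N.mul_mem (N.zpow_mem ha i) (N.zpow_mem hb j))

/-- Two non-commuting elements generate `N` modulo the center, so it suffices to conjugate those. -/
theorem conj_mem (hN : IsHeisenberg p N) {a b G : Γ} (ha : a ∈ N) (hb : b ∈ N)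
    (hab : ¬ Commute a b) (hGa : G * a * G⁻¹ ∈ N) (hGb : G * b * G⁻¹ ∈ N) {n : Γ} (hn : n ∈ N) :
    G * n * G⁻¹ ∈ N := by
  obtain ⟨s, hs, i, j, rfl⟩ := hN.exists_eq_mul_zpow ha hb hab (hN.commute_mk n hn a ha)
    (hN.commute_mk n hn b hb)
  have : G * (s * (a ^ i * b ^ j)) * G⁻¹ = s * ((G * a * G⁻¹) ^ i * (G * b * G⁻¹) ^ j) := by
    rw [conj_zpow, conj_zpow, ← mul_assoc G s, Subgroup.mem_center_iff.1 hs G]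
    group
  rw [this]
  exact N.mul_mem (hN.center_le hs) (N.mul_mem (N.zpow_mem hGa i) (N.zpow_mem hGb j))

/-- If `G` conjugates two non-commuting elements `a, b` of `N` into `N`, then so does its inverse
for all of `N`, because `G⁻¹ n G` commutes modulo the center with `a` and `b`. -/
theorem conj_inv_mem (hN : IsHeisenberg p N) {a b G : Γ} (ha : a ∈ N) (hb : b ∈ N)
    (hab : ¬ Commute a b) (hGa : G * a * G⁻¹ ∈ N) (hGb : G * b * G⁻¹ ∈ N) {n : Γ} (hn : n ∈ N) :
    G⁻¹ * n * G ∈ N := by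
  apply hN.mem_of_commute_mk ha hb hab
  · have := commute_mk_conj (A := G⁻¹) (hN.commute_mk n hn _ hGa)
    convert this using 2 <;> group
  · have := commute_mk_conj (A := G⁻¹) (hN.commute_mk n hn _ hGb)
    convert this using 2 <;> group

theorem exists_not_commute_of_notMem_center (hN : IsHeisenberg p N) {a : Γ}
    (haS : a ∉ Subgroup.center Γ) : ∃ x ∈ N, ¬ Commute a x := by
  obtain ⟨x, hx, z, hz, hxz⟩ := hN.exists_not_commute
  by_contra! h
  exact haS (hN.mem_center x hx z hz hxz a (h x hx) (h z hz))

/-- Commuting elements of `N` are proportional modulo the center: the commutator pairing is a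
nondegenerate alternating form on a plane. -/
theorem mk_eq_zpow (hN : IsHeisenberg p N) {a b : Γ} (ha : a ∈ N)
    (haS : a ∉ Subgroup.center Γ) (hb : b ∈ N) (hab : Commute a b) :
    ∃ i : ℤ, modCenter b = modCenter a ^ i := by
  obtain ⟨x, hx, hax⟩ := hN.exists_not_commute_of_notMem_center haS
  have hax' := hN.commute_mk a ha x hx
  have hbx' := hN.commute_mk b hb x hx
  obtain ⟨i, hi⟩ := hN.exists_zpow_eq ⁅a, x⁆ (commute_mk_iff.1 hax') ⁅b, x⁆
    (commute_mk_iff.1 hbx') (commutator_pow_eq_one hax' (hN.pow_mem x hx))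
    (commutator_pow_eq_one hbx' (hN.pow_mem x hx))
    (fun h => hax (commutatorElement_eq_one_iff_commute.1 h))
  refine ⟨i, ?_⟩
  rw [← map_zpow, ← mul_inv_eq_one, ← map_inv, ← map_mul, mk_eq_one_iff]
  refine hN.mem_center a ha x hx hax _ ?_ ?_
  · exact hab.symm.mul_left ((Commute.refl a).zpow_left i).inv_left
  · rw [← commutatorElement_eq_one_iff_commute, ← _root_.zpow_neg, commutator_mul_left,
      commutator_zpow_left hax', ← hi, ← _root_.zpow_add, add_neg_cancel, zpow_zero]
    rw [map_zpow]
    exact hax'.zpow_left _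

theorem finite_map (hN : IsHeisenberg p N) (hp : p ≠ 0) : Finite (N.map modCenter) := by
  obtain ⟨a, ha, b, hb, hab⟩ := hN.exists_not_commute
  have hfin : ∀ c ∈ N, (Subgroup.zpowers (modCenter c) : Set (Γ ⧸ Subgroup.center Γ)).Finite := by
    intro c hc
    refine finite_zpowers.2 (isOfFinOrder_iff_pow_eq_one.2 ⟨p, Nat.pos_of_ne_zero hp, ?_⟩)
    rw [← map_pow, mk_eq_one_iff]
    exact hN.pow_mem c hc
  refine Set.Finite.subset ((hfin a ha).image2 (· * ·) (hfin b hb)) ?_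
  rintro _ ⟨n, hn, rfl⟩
  obtain ⟨s, hs, i, j, rfl⟩ := hN.exists_eq_mul_zpow ha hb hab (hN.commute_mk n hn a ha)
    (hN.commute_mk n hn b hb)
  refine ⟨modCenter a ^ i, ⟨i, rfl⟩, modCenter b ^ j, ⟨j, rfl⟩, ?_⟩
  rw [map_mul, mk_eq_one_iff.2 hs, one_mul, map_mul, map_zpow, map_zpow]

/-- A version of `exists_commute_of_normalizes` for a subgroup `V` of `N` modulo the center. -/
theorem exists_commute_mk_of_normalizes [Fact p.Prime] (hN : IsHeisenberg p N) {A : Γ}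
    (hA : A ^ p ∈ Subgroup.center Γ) (V : Subgroup (Γ ⧸ Subgroup.center Γ))
    (hV : V ≤ N.map modCenter) (hV1 : V ≠ ⊥)
    (hAV : ∀ v ∈ V, modCenter A * v * (modCenter A)⁻¹ ∈ V) :
    ∃ u ∈ N, u ∉ Subgroup.center Γ ∧ Commute (modCenter A) (modCenter u) := by
  have := hN.finite_map (Fact.out : p.Prime).ne_zero
  have : Finite V := Finite.of_injective _ (Subgroup.inclusion_injective hV)
  have hVp : IsPGroup p V := by
    rintro ⟨v, hv⟩
    obtain ⟨n, hn, rfl⟩ := hV hv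
    refine ⟨1, Subtype.ext ?_⟩
    show modCenter n ^ p ^ 1 = 1
    rw [pow_one, ← map_pow, mk_eq_one_iff]
    exact hN.pow_mem n hn
  obtain ⟨v, hv, hv1, hAv⟩ := exists_commute_of_normalizes V hVp hV1 (modCenter A)
    (by rwa [← map_pow, mk_eq_one_iff]) hAV
  obtain ⟨n, hn, rfl⟩ := hV hv
  exact ⟨n, hn, fun h => hv1 (mk_eq_one_iff.2 h), hAv⟩

/-- The heart of the matter. Suppose `A ^ p` is central, and both `A` and `A ^ 2` conjugate some
noncentral element of `N` into `N`. Then `A` commutes with a noncentral element of `N` modulo the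
center.

Let `u` and `w` be the noncentral elements for `A` and `A ^ 2`, and `u' = A u A⁻¹`. If `u` and
`u'` commute, then `A` normalizes the group generated by `u`. Otherwise,
`A w A⁻¹ = A⁻¹ (A ^ 2 w A ^ (-2)) A` commutes modulo the center with both `u'` and `u`, hence
lies in `N`, and it follows that `A` normalizes all of `N`. In both cases there is a fixed point. -/
theorem exists_commute_mk [Fact p.Prime] (hN : IsHeisenberg p N) {A : Γ}
    (hA : A ^ p ∈ Subgroup.center Γ)
    (h1 : ∃ u ∈ N, u ∉ Subgroup.center Γ ∧ A * u * A⁻¹ ∈ N)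
    (h2 : ∃ u ∈ N, u ∉ Subgroup.center Γ ∧ A ^ 2 * u * (A ^ 2)⁻¹ ∈ N) :
    ∃ u ∈ N, u ∉ Subgroup.center Γ ∧ Commute (modCenter A) (modCenter u) := by
  obtain ⟨u, hu, huS, hu'⟩ := h1
  by_cases huu : Commute u (A * u * A⁻¹)
  · obtain ⟨i, hi⟩ := hN.mk_eq_zpow hu huS hu' huu
    refine hN.exists_commute_mk_of_normalizes hA (Subgroup.zpowers (modCenter u)) ?_ ?_ ?_
    · rw [Subgroup.zpowers_le]
      exact ⟨u, hu, rfl⟩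
    · rw [Ne, Subgroup.zpowers_eq_bot, mk_eq_one_iff]
      exact huS
    · rintro _ ⟨j, rfl⟩
      rw [map_mul, map_mul, map_inv] at hi
      show modCenter A * modCenter u ^ j * (modCenter A)⁻¹ ∈ _
      rw [← conj_zpow, hi, ← _root_.zpow_mul]
      exact ⟨_, rfl⟩
  · have hnorm : ∀ n ∈ N, A * n * A⁻¹ ∈ N := by
      obtain ⟨w, hw, hwS, hw'⟩ := h2
      have hY : A * w * A⁻¹ ∈ N := by
        refine hN.mem_of_commute_mk hu hu' huu ?_ (commute_mk_conj (hN.commute_mk w hw u hu))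
        have := commute_mk_conj (A := A⁻¹) (hN.commute_mk _ hw' _ hu')
        convert this using 2 <;> group
      by_cases hwu : Commute w u
      · have hYu : ¬ Commute u (A * w * A⁻¹) := by
          intro h
          obtain ⟨i, hi⟩ := hN.mk_eq_zpow hw hwS hu hwu
          obtain ⟨s, hs, hus⟩ := mk_eq_mk_iff.1 (hi.trans (map_zpow _ _ _).symm)
          apply huu
          have : A * u * A⁻¹ = s * (A * w * A⁻¹) ^ i := by
            rw [conj_zpow, hus, ← mul_assoc A s, Subgroup.mem_center_iff.1 hs A]
            group
          rw [this]
          exact Commute.mul_right (Subgroup.mem_center_iff.1 hs u) (h.zpow_right i)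
        refine fun n hn => hN.conj_mem hu hY hYu hu' ?_ hn
        convert hw' using 1
        rw [pow_two]
        group
      · exact fun n hn => hN.conj_mem hw hu hwu hY hu' hn
    refine hN.exists_commute_mk_of_normalizes hA (N.map modCenter) le_rfl ?_ ?_
    · intro h
      have : modCenter u ∈ N.map modCenter := ⟨u, hu, rfl⟩
      rw [h, Subgroup.mem_bot, mk_eq_one_iff] at this
      exact huS this
    · rintro _ ⟨n, hn, rfl⟩
      exact ⟨A * n * A⁻¹, hnorm n hn, by simp only [map_mul, map_inv]⟩

/-- The induction step for the semi-Clifford property. Let `x, z ∈ N` be non-commuting, with images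
`A = G x G⁻¹` and `B = G z G⁻¹`. By `exists_commute_mk` there are noncentral `a, b, c ∈ N` commuting
modulo the center with `A`, `B` and `A B`, respectively. If `a` and `b` commute, then `a` commutes
modulo the center with both `A` and `B`, so that `G⁻¹ a G ∈ N`. If they do not, then
`B c B⁻¹`, which modulo the center is `A⁻¹ c A`, has the same commutators with `a` and with `b`
as `c`. So `A` and `B` commute with `c` modulo the center, and this forces `A ∈ N` or `B ∈ N`. -/
theorem exists_conj_mem [Fact p.Prime] (hN : IsHeisenberg p N) {G : Γ}
    (h : ∀ n ∈ N, ∃ u ∈ N, u ∉ Subgroup.center Γ ∧ (G * n * G⁻¹) * u * (G * n * G⁻¹)⁻¹ ∈ N) :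
    ∃ u ∈ N, u ∉ Subgroup.center Γ ∧ G * u * G⁻¹ ∈ N := by
  have key : ∀ n ∈ N, ∃ u ∈ N, u ∉ Subgroup.center Γ ∧
      Commute (modCenter (G * n * G⁻¹)) (modCenter u) := by
    intro n hn
    apply hN.exists_commute_mk _ (h n hn)
    · have := h (n ^ 2) (N.pow_mem hn 2)
      rwa [← conj_pow] at this
    · rw [conj_pow]
      exact (inferInstance : (Subgroup.center Γ).Normal).conj_mem _ (hN.pow_mem n hn) G
  obtain ⟨x, hx, z, hz, hxz⟩ := hN.exists_not_commute
  have hxS : x ∉ Subgroup.center Γ := fun h => hxz (Subgroup.mem_center_iff.1 h z).symm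
  have hzS : z ∉ Subgroup.center Γ := fun h => hxz (Subgroup.mem_center_iff.1 h x)
  obtain ⟨a, ha, haS, hAa⟩ := key x hx
  obtain ⟨b, hb, hbS, hBb⟩ := key z hz
  obtain ⟨c, hc, hcS, hABc⟩ := key (x * z) (N.mul_mem hx hz)
  by_cases hab : Commute a b
  · have hBa : Commute (modCenter (G * z * G⁻¹)) (modCenter a) := by
      obtain ⟨i, hi⟩ := hN.mk_eq_zpow hb hbS ha hab.symm
      rw [hi]
      exact hBb.zpow_right i
    refine ⟨G⁻¹ * a * G, ?_, ?_, ?_⟩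
    · apply hN.mem_of_commute_mk hx hz hxz
      · have := commute_mk_conj (A := G⁻¹) hAa.symm
        convert this using 2 <;> group
      · have := commute_mk_conj (A := G⁻¹) hBa.symm
        convert this using 2 <;> group
    · have := not_mem_center_conj (A := G⁻¹) haS
      rwa [inv_inv] at this
    · convert ha using 1
      group
  · set A := G * x * G⁻¹ with hA
    set B := G * z * G⁻¹ with hB
    have hAB : G * (x * z) * G⁻¹ = A * B := by rw [hA, hB]; group
    rw [hAB, commute_mk_iff] at hABc
    set s := ⁅A * B, c⁆ with hs
    have hsc := Subgroup.mem_center_iff.1 hABc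
    have hY : B * c * B⁻¹ = s * (A⁻¹ * c * A) := by
      calc B * c * B⁻¹ = A⁻¹ * (s * c) * A := by rw [hs, commutatorElement_def]; group
        _ = s * (A⁻¹ * c * A) := by rw [← mul_assoc A⁻¹ s, hsc]; group
    have hBc : Commute ⁅B, c⁆ b := commute_commutator hBb (hN.commute_mk c hc b hb)
    have hAc : Commute ⁅A⁻¹, c⁆ a := by
      refine commute_commutator ?_ (hN.commute_mk c hc a ha)
      rw [map_inv]
      exact hAa.inv_left
    have hBA : ⁅B, c⁆ = s * ⁅A⁻¹, c⁆ := by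
      rw [commutatorElement_def, hY, commutatorElement_def]
      group
    have hBcS : ⁅B, c⁆ ∈ Subgroup.center Γ := by
      refine hN.mem_center a ha b hb hab _ ?_ hBc
      rw [hBA]
      exact Commute.mul_left (hsc a).symm hAc
    have hAcS : Commute (modCenter A) (modCenter c) := by
      have : ⁅A⁻¹, c⁆ ∈ Subgroup.center Γ := by
        rw [eq_inv_mul_of_mul_eq hBA.symm]
        exact mul_mem (inv_mem hABc) hBcS
      have := (commute_mk_iff.2 this).inv_left
      rwa [map_inv, inv_inv] at this
    by_cases hca : Commute a c
    · have hcb : ¬ Commute b c := fun hcb => hcS (hN.mem_center a ha b hb hab c hca.symm hcb.symm)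
      exact ⟨z, hz, hzS, hN.mem_of_commute_mk hb hc hcb hBb (commute_mk_iff.2 hBcS)⟩
    · exact ⟨x, hx, hxS, hN.mem_of_commute_mk ha hc hca hAa hAcS⟩

end IsHeisenberg
end Heisenberg

/-! ### Powers of products and of torsion elements -/

/-- The collection formula for two elements whose commutator is central. -/
theorem mul_pow_eq_of_commute_mk {Γ : Type*} [Group Γ] {a b : Γ}
    (H : Commute (modCenter b) (modCenter a)) (n : ℕ) :
    (a * b) ^ n = ⁅b, a⁆ ^ n.choose 2 * (a ^ n * b ^ n) := by
  have hc := Subgroup.mem_center_iff.1 (commute_mk_iff.1 H)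
  induction n with
  | zero => simp
  | succ n ih =>
    have hy : ∀ m : ℕ, ∀ g : Γ, g * ⁅b, a⁆ ^ m = ⁅b, a⁆ ^ m * g := fun m g =>
      Commute.pow_right (hc g) m
    have hba : b ^ n * a = ⁅b, a⁆ ^ n * (a * b ^ n) := by
      rw [← commutator_pow_left H, commutatorElement_def]
      group
    calc (a * b) ^ (n + 1) = ⁅b, a⁆ ^ n.choose 2 * (a ^ n * (b ^ n * a) * b) := by
          rw [pow_succ, ih]; simp only [mul_assoc]
      _ = ⁅b, a⁆ ^ n.choose 2 * (⁅b, a⁆ ^ n * (a ^ n * (a * b ^ n) * b)) := by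
          rw [hba, ← mul_assoc (a ^ n), hy n (a ^ n)]; simp only [mul_assoc]
      _ = ⁅b, a⁆ ^ (n + 1).choose 2 * (a ^ (n + 1) * b ^ (n + 1)) := by
          rw [Nat.choose_succ_succ' n 1, Nat.choose_one_right, add_comm n, pow_add, pow_succ a,
            pow_succ b]
          simp only [mul_assoc]

section Torsion

variable {Γ : Type*} [Group Γ] {d : ℕ} {y : Γ}

theorem zpow_eq_zpow_of_cast_eq (hy : y ^ d = 1) {m n : ℤ} (h : (m : ZMod d) = n) :
    y ^ m = y ^ n := by
  rw [zpow_eq_zpow_iff_modEq]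
  exact ((ZMod.intCast_eq_intCast_iff _ _ _).1 h).of_dvd
    (Int.natCast_dvd_natCast.2 (orderOf_dvd_of_pow_eq_one hy))

theorem exists_zpow_zpow_eq [Fact d.Prime] (hy : y ^ d = 1) {n : ℤ} (h : (n : ZMod d) ≠ 0) :
    ∃ m : ℤ, (y ^ n) ^ m = y := by
  refine ⟨((n : ZMod d)⁻¹).val, ?_⟩
  rw [← _root_.zpow_mul]
  conv_rhs => rw [← zpow_one y]
  apply zpow_eq_zpow_of_cast_eq hy
  have : NeZero d := ⟨(Fact.out : d.Prime).ne_zero⟩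
  push_cast
  rw [ZMod.natCast_zmod_val, mul_inv_cancel₀ h]

theorem exists_pow_eq_zpow (d : ℕ) [NeZero d] (hy : y ^ d = 1) (n : ℤ) :
    ∃ m : ℕ, y ^ n = y ^ m := by
  refine ⟨(n : ZMod d).val, ?_⟩
  rw [← zpow_natCast]
  apply zpow_eq_zpow_of_cast_eq hy
  simp

end Torsion

/-! ### The Pauli group as a Heisenberg group -/

section Matrices

variable (d : ℕ) [NeZero d]

theorem pauliZ_apply (i j : ZMod d) :
    (pauliZ d : Matrix (ZMod d) (ZMod d) ℂ) i j = if i = j then ZMod.stdAddChar i else 0 := by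
  simp [pauliZ, Matrix.diagonal_apply]

theorem pauliX_apply (i j : ZMod d) :
    (pauliX d : Matrix (ZMod d) (ZMod d) ℂ) i j = if i = j + 1 then 1 else 0 := rfl

theorem pauliZ_pow (n : ℕ) : ((pauliZ d ^ n : Gate d) : Matrix (ZMod d) (ZMod d) ℂ) =
    Matrix.diagonal fun z => ZMod.stdAddChar ((n : ZMod d) * z) := by
  rw [SubmonoidClass.coe_pow, pauliZ, Matrix.diagonal_pow]
  congr 1
  funext z
  rw [Pi.pow_apply, ← AddChar.map_nsmul_eq_pow, nsmul_eq_mul]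

theorem mul_pauliX_apply (A : Matrix (ZMod d) (ZMod d) ℂ) (i j : ZMod d) :
    (A * (pauliX d : Matrix (ZMod d) (ZMod d) ℂ)) i j = A i (j + 1) := by
  simp [Matrix.mul_apply, pauliX_apply]

theorem pauliX_mul_apply (A : Matrix (ZMod d) (ZMod d) ℂ) (i j : ZMod d) :
    ((pauliX d : Matrix (ZMod d) (ZMod d) ℂ) * A) i j = A (i - 1) j := by
  simp [Matrix.mul_apply, pauliX_apply, ← sub_eq_iff_eq_add]

theorem pauliX_pow_apply (n : ℕ) (i j : ZMod d) :
    ((pauliX d ^ n : Gate d) : Matrix (ZMod d) (ZMod d) ℂ) i j = if i = j + n then 1 else 0 := by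
  induction n generalizing i j with
  | zero => simp [Matrix.one_apply]
  | succ n ih =>
    rw [SubmonoidClass.coe_pow] at ih ⊢
    rw [pow_succ, mul_pauliX_apply, ih]
    congr 2
    push_cast
    ring

theorem pauliZ_pow_card : pauliZ d ^ d = 1 := by
  apply Subtype.ext
  rw [pauliZ_pow]
  simp

theorem pauliX_pow_card : pauliX d ^ d = 1 := by
  apply Subtype.ext
  ext i j
  rw [pauliX_pow_apply]
  simp [Matrix.one_apply]

theorem isDiag_of_commute_pauliZ {D : Gate d} (h : Commute D (pauliZ d)) :
    (D : Matrix (ZMod d) (ZMod d) ℂ).IsDiag := by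
  intro i j hij
  have := congrFun₂ (congrArg (Subtype.val) h.eq) i j
  simp only [pauliZ, Submonoid.coe_mul, Matrix.mul_diagonal, Matrix.diagonal_mul] at this
  rw [mul_comm] at this
  by_contra h0
  exact hij (ZMod.injective_stdAddChar (mul_right_cancel₀ h0 this)).symm

theorem commute_pauliZ_of_isDiag {D : Gate d} (h : (D : Matrix (ZMod d) (ZMod d) ℂ).IsDiag) :
    Commute D (pauliZ d) := by
  apply Subtype.ext
  rw [Submonoid.coe_mul, Submonoid.coe_mul, ← h.diagonal_diag, pauliZ, Matrix.diagonal_mul_diagonal,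
    Matrix.diagonal_mul_diagonal]
  congr 1
  funext z
  exact mul_comm _ _

theorem coe_eq_smul_one_of_commute {g : Gate d} (hZ : Commute g (pauliZ d))
    (hX : Commute g (pauliX d)) :
    (g : Matrix (ZMod d) (ZMod d) ℂ) =
      (g : Matrix (ZMod d) (ZMod d) ℂ) 0 0 • (1 : Matrix (ZMod d) (ZMod d) ℂ) := by
  have hdiag := isDiag_of_commute_pauliZ d hZ
  have hstep : ∀ j : ZMod d, (g : Matrix (ZMod d) (ZMod d) ℂ) (j + 1) (j + 1) =
      (g : Matrix (ZMod d) (ZMod d) ℂ) j j := by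
    intro j
    have := congrFun₂ (congrArg (Subtype.val) hX.eq) (j + 1) j
    rw [Submonoid.coe_mul, Submonoid.coe_mul, mul_pauliX_apply, pauliX_mul_apply,
      add_sub_cancel_right] at this
    exact this
  have hconst : ∀ n : ℕ, (g : Matrix (ZMod d) (ZMod d) ℂ) n n =
      (g : Matrix (ZMod d) (ZMod d) ℂ) 0 0 := by
    intro n
    induction n with
    | zero => simp
    | succ n ih =>
      push_cast
      rw [hstep, ih]
  ext i j
  rw [Matrix.smul_apply, Matrix.one_apply]
  split_ifs with hij
  · subst hij
    have := hconst i.val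
    rw [ZMod.natCast_zmod_val] at this
    simp [this]
  · simpa using hdiag hij

theorem mem_center_of_coe_eq {g : Gate d} {c : ℂ}
    (h : (g : Matrix (ZMod d) (ZMod d) ℂ) = c • (1 : Matrix (ZMod d) (ZMod d) ℂ)) :
    g ∈ Subgroup.center (Gate d) := by
  rw [Subgroup.mem_center_iff]
  intro x
  apply Subtype.ext
  rw [Submonoid.coe_mul, Submonoid.coe_mul, h]
  simp

/-- The center of the unitary group consists of the scalars. -/
theorem mem_center_iff_exists_smul {g : Gate d} : g ∈ Subgroup.center (Gate d) ↔
    ∃ c : ℂ, (g : Matrix (ZMod d) (ZMod d) ℂ) = c • (1 : Matrix (ZMod d) (ZMod d) ℂ) := by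
  constructor
  · intro h
    have h' := Subgroup.mem_center_iff.1 h
    exact ⟨_, coe_eq_smul_one_of_commute d (h' _).symm (h' _).symm⟩
  · rintro ⟨c, h⟩
    exact mem_center_of_coe_eq d h

theorem mem_center_of_commute {g : Gate d} (hZ : Commute g (pauliZ d)) (hX : Commute g (pauliX d)) :
    g ∈ Subgroup.center (Gate d) :=
  mem_center_of_coe_eq d (coe_eq_smul_one_of_commute d hZ hX)

theorem modCenter_eq_of_coe_eq_smul {g h : Gate d} {c : ℂ}
    (H : (g : Matrix (ZMod d) (ZMod d) ℂ) = c • (h : Matrix (ZMod d) (ZMod d) ℂ)) :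
    modCenter g = modCenter h := by
  rw [← mul_inv_eq_one, ← map_inv, ← map_mul, mk_eq_one_iff]
  apply mem_center_of_coe_eq d (c := c)
  rw [Submonoid.coe_mul, H, smul_mul_assoc, ← Submonoid.coe_mul, mul_inv_cancel]
  rfl

theorem commutator_pauliZ_pauliX : ((⁅pauliZ d, pauliX d⁆ : Gate d) : Matrix (ZMod d) (ZMod d) ℂ) =
    (ZMod.stdAddChar (1 : ZMod d) : ℂ) • (1 : Matrix (ZMod d) (ZMod d) ℂ) := by
  have h : ((pauliZ d * pauliX d : Gate d) : Matrix (ZMod d) (ZMod d) ℂ) =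
      (ZMod.stdAddChar (1 : ZMod d) : ℂ) • ((pauliX d * pauliZ d : Gate d) :
        Matrix (ZMod d) (ZMod d) ℂ) := by
    ext i j
    rw [Submonoid.coe_mul, Submonoid.coe_mul, mul_pauliX_apply, Matrix.smul_apply, pauliX_mul_apply,
      pauliZ_apply, pauliZ_apply]
    by_cases hij : i = j + 1
    · subst hij
      simp [AddChar.map_add_eq_mul, mul_comm]
    · simp [hij, sub_eq_iff_eq_add]
  have h2 : ⁅pauliZ d, pauliX d⁆ = (pauliZ d * pauliX d) * (pauliX d * pauliZ d)⁻¹ := by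
    rw [commutatorElement_def]; group
  rw [h2, Submonoid.coe_mul, h, smul_mul_assoc, ← Submonoid.coe_mul, mul_inv_cancel]
  rfl

theorem commutator_mem_center : ⁅pauliZ d, pauliX d⁆ ∈ Subgroup.center (Gate d) :=
  mem_center_of_coe_eq d (commutator_pauliZ_pauliX d)

theorem commute_mk_pauli : Commute (modCenter (pauliZ d)) (modCenter (pauliX d)) :=
  commute_mk_iff.2 (commutator_mem_center d)

theorem commutator_pow_card : ⁅pauliZ d, pauliX d⁆ ^ d = 1 :=
  commutator_pow_eq_one (commute_mk_pauli d) (by rw [pauliX_pow_card]; exact one_mem _)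

/-- The Pauli gates, multiplied by arbitrary scalars of modulus one: the gates which, modulo the
center of the unitary group, are products of powers of `Z` and `X`. -/
def projPauli : Subgroup (Gate d) where
  carrier := {U | ∃ i j : ℤ, modCenter U = modCenter (pauliZ d) ^ i * modCenter (pauliX d) ^ j}
  one_mem' := ⟨0, 0, by simp⟩
  mul_mem' := by
    rintro U V ⟨i, j, hU⟩ ⟨k, l, hV⟩
    refine ⟨i + k, j + l, ?_⟩
    rw [map_mul, hU, hV, _root_.zpow_add, _root_.zpow_add]
    exact (((commute_mk_pauli d).symm.zpow_left j).zpow_right k).mul_mul_mul_comm _ _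
  inv_mem' := by
    rintro U ⟨i, j, hU⟩
    refine ⟨-i, -j, ?_⟩
    rw [map_inv, hU, _root_.zpow_neg, _root_.zpow_neg]
    exact ((commute_mk_pauli d).zpow_zpow i j).mul_inv

variable {d}

theorem pauliZ_mem : pauliZ d ∈ projPauli d := ⟨1, 0, by simp⟩

theorem pauliX_mem : pauliX d ∈ projPauli d := ⟨0, 1, by simp⟩

/-- The commutator of two Pauli gates is given by the symplectic form of their exponents. -/
theorem commutator_eq_zpow {a b : Gate d} {i j k l : ℤ}
    (ha : modCenter a = modCenter (pauliZ d) ^ i * modCenter (pauliX d) ^ j)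
    (hb : modCenter b = modCenter (pauliZ d) ^ k * modCenter (pauliX d) ^ l) :
    ⁅a, b⁆ = ⁅pauliZ d, pauliX d⁆ ^ (i * l - j * k) := by
  have hZX := commute_mk_pauli d
  rw [← map_zpow, ← map_zpow, ← map_mul] at ha hb
  have hcomm : ∀ g h e : Gate d, modCenter g = modCenter h → ⁅g, e⁆ = ⁅h, e⁆ := by
    intro g h e H
    obtain ⟨s, hs, rfl⟩ := mk_eq_mk_iff.1 H
    have hs' := Subgroup.mem_center_iff.1 hs
    calc ⁅s * h, e⁆ = s * (h * e * h⁻¹) * (s⁻¹ * e⁻¹) := by rw [commutatorElement_def]; group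
      _ = ⁅h, e⁆ := by rw [← hs' (h * e * h⁻¹), commutatorElement_def]; group
  have hZ : ⁅pauliZ d, b⁆ = ⁅pauliZ d, pauliX d⁆ ^ l := by
    rw [← commutatorElement_inv, hcomm _ _ _ hb, commutator_mul_left,
      commutatorElement_eq_one_iff_commute.2 ((Commute.refl (pauliZ d)).zpow_left k), one_mul,
      commutator_zpow_left hZX.symm, ← _root_.inv_zpow, commutatorElement_inv]
    rw [map_zpow]
    exact hZX.symm.zpow_left l
  have hX : ⁅pauliX d, b⁆ = ⁅pauliZ d, pauliX d⁆ ^ (-k) := by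
    rw [← commutatorElement_inv, hcomm _ _ _ hb, commutator_mul_left,
      commutatorElement_eq_one_iff_commute.2 ((Commute.refl (pauliX d)).zpow_left l), mul_one,
      commutator_zpow_left hZX, _root_.zpow_neg]
    rw [map_zpow]
    exact (Commute.refl _).zpow_left l
  have hZb : Commute (modCenter (pauliZ d)) (modCenter b) := by
    rw [hb, map_mul, map_zpow, map_zpow]
    exact ((Commute.refl _).zpow_right k).mul_right (hZX.zpow_right l)
  have hXb : Commute (modCenter (pauliX d)) (modCenter b) := by
    rw [hb, map_mul, map_zpow, map_zpow]
    exact (hZX.symm.zpow_right k).mul_right ((Commute.refl _).zpow_right l)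
  rw [hcomm _ _ _ ha, commutator_mul_left, commutator_zpow_left hZb, commutator_zpow_left hXb, hZ,
    hX, ← _root_.zpow_mul, ← _root_.zpow_mul, ← _root_.zpow_add]
  · congr 1
    ring
  · rw [map_zpow]
    exact hXb.zpow_left j

end Matrices

section Prime

variable {d : ℕ} [Fact d.Prime]

theorem commute_iff_cast_eq_zero {a b : Gate d} {i j k l : ℤ}
    (ha : modCenter a = modCenter (pauliZ d) ^ i * modCenter (pauliX d) ^ j)
    (hb : modCenter b = modCenter (pauliZ d) ^ k * modCenter (pauliX d) ^ l) :
    Commute a b ↔ ((i * l - j * k : ℤ) : ZMod d) = 0 := by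
  rw [← commutatorElement_eq_one_iff_commute, commutator_eq_zpow ha hb]
  constructor
  · intro h
    by_contra hne
    obtain ⟨m, hm⟩ := exists_zpow_zpow_eq (commutator_pow_card d) hne
    rw [h, _root_.one_zpow] at hm
    have h1 := commutator_pauliZ_pauliX d
    rw [← hm] at h1
    have h2 := congrFun₂ h1 0 0
    simp only [OneMemClass.coe_one, Matrix.smul_apply, Matrix.one_apply_eq, smul_eq_mul,
      mul_one] at h2
    rw [← AddChar.map_zero_eq_one (ZMod.stdAddChar (N := d))] at h2
    exact zero_ne_one (ZMod.injective_stdAddChar h2)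
  · intro h
    rw [zpow_eq_zpow_of_cast_eq (commutator_pow_card d) (n := 0) (by simpa using h), zpow_zero]

theorem not_commute_pauliZ_pauliX : ¬ Commute (pauliZ d) (pauliX d) := by
  rw [commute_iff_cast_eq_zero (i := 1) (j := 0) (k := 0) (l := 1) (by simp) (by simp)]
  simp

variable (d) in
/-- The Pauli gates with arbitrary scalars form a Heisenberg group. -/
theorem isHeisenberg_projPauli : IsHeisenberg d (projPauli d) where
  center_le := fun s hs => ⟨0, 0, by simpa using mk_eq_one_iff.2 hs⟩
  commute_mk := by
    rintro a ⟨i, j, ha⟩ b ⟨k, l, hb⟩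
    have hZX := commute_mk_pauli d
    rw [ha, hb]
    exact Commute.mul_left
      (((Commute.refl _).zpow_zpow i k).mul_right (hZX.zpow_zpow i l))
      ((hZX.symm.zpow_zpow j k).mul_right ((Commute.refl _).zpow_zpow j l))
  pow_mem := by
    rintro a ⟨i, j, ha⟩
    have hZX := commute_mk_pauli d
    rw [← mk_eq_one_iff, map_pow, ha, (hZX.zpow_zpow i j).mul_pow, ← zpow_natCast, ← zpow_natCast,
      zpow_comm, zpow_comm _ j, zpow_natCast, zpow_natCast, ← map_pow, ← map_pow, pauliZ_pow_card,
      pauliX_pow_card]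
    simp
  mem_center := by
    rintro a ⟨i, j, ha⟩ b ⟨k, l, hb⟩ hab g hga hgb
    have hZX := commute_mk_pauli d
    rw [commute_iff_cast_eq_zero ha hb] at hab
    -- Suitable products of powers of `a` and `b` are proportional to powers of `Z` and of `X` whose
    -- exponent is the determinant `i l - j k`, which is invertible modulo `d`.
    have key : ∀ m n : ℤ, ∀ y : Gate d, y ^ d = 1 →
        modCenter (a ^ m * b ^ n) = modCenter (y ^ (i * l - j * k)) → Commute g y := by
      intro m n y hy h
      obtain ⟨s, hs, h'⟩ := mk_eq_mk_iff.1 h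
      have hc : Commute g (y ^ (i * l - j * k)) := by
        rw [eq_inv_mul_of_mul_eq h'.symm]
        exact Commute.mul_right (Subgroup.mem_center_iff.1 (inv_mem hs) g)
          ((hga.zpow_right m).mul_right (hgb.zpow_right n))
      obtain ⟨r, hr⟩ := exists_zpow_zpow_eq hy hab
      rw [← hr]
      exact hc.zpow_right r
    have hprod : ∀ m n : ℤ, modCenter (a ^ m * b ^ n) =
        modCenter (pauliZ d) ^ (i * m + k * n) * modCenter (pauliX d) ^ (j * m + l * n) := by
      intro m n
      rw [map_mul, map_zpow, map_zpow, ha, hb, (hZX.zpow_zpow i j).mul_zpow,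
        (hZX.zpow_zpow k l).mul_zpow, ← _root_.zpow_mul, ← _root_.zpow_mul, ← _root_.zpow_mul,
        ← _root_.zpow_mul, _root_.zpow_add, _root_.zpow_add]
      exact (hZX.symm.zpow_zpow (j * m) (k * n)).mul_mul_mul_comm _ _
    apply mem_center_of_commute d
    · apply key l (-j) _ (pauliZ_pow_card d)
      rw [hprod, map_zpow, show j * l + l * -j = 0 by ring, zpow_zero, mul_one]
      congr 1
      ring
    · apply key (-k) i _ (pauliX_pow_card d)
      rw [hprod, map_zpow, show i * -k + k * i = 0 by ring, zpow_zero, one_mul]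
      congr 1
      ring
  exists_zpow_eq := by
    intro y hy z hz hyd hzd hy1
    obtain ⟨c, hc⟩ := (mem_center_iff_exists_smul d).1 hy
    obtain ⟨e, he⟩ := (mem_center_iff_exists_smul d).1 hz
    have hpow : ∀ (g : Gate d) (c : ℂ) (n : ℕ), (g : Matrix (ZMod d) (ZMod d) ℂ) = c • 1 →
        ((g ^ n : Gate d) : Matrix (ZMod d) (ZMod d) ℂ) = c ^ n • 1 := by
      intro g c n h
      rw [SubmonoidClass.coe_pow, h, smul_pow, one_pow]
    have hone : ∀ c : ℂ, (1 : Matrix (ZMod d) (ZMod d) ℂ) = c • 1 → c = 1 := by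
      intro c h
      have := congrFun₂ h 0 0
      simpa using this.symm
    have hcd : c ^ d = 1 := hone _ (by rw [← hpow y c d hc, hyd]; rfl)
    have hed : e ^ d = 1 := hone _ (by rw [← hpow z e d he, hzd]; rfl)
    have hc1 : c ≠ 1 := by
      rintro rfl
      exact hy1 (Subtype.ext (by rw [hc, one_smul]; rfl))
    have hprim : IsPrimitiveRoot c d := by
      rw [← orderOf_eq_prime hcd hc1]
      exact IsPrimitiveRoot.orderOf c
    obtain ⟨n, -, hn⟩ := hprim.eq_pow_of_pow_eq_one hed
    refine ⟨n, Subtype.ext ?_⟩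
    rw [zpow_natCast, hpow y c n hc, hn, he]
  exists_not_commute := ⟨_, pauliZ_mem, _, pauliX_mem, not_commute_pauliZ_pauliX⟩

end Prime

/-! ### The levels of the Clifford hierarchy -/

section Levels

variable {d : ℕ} [Fact d.Prime]

variable (d) in
/-- The order of the scalar `pauliPhase d`, which is also an exponent of the Pauli group. -/
def phaseOrder : ℕ := if d = 2 then 4 else d

theorem isPrimitiveRoot_pauliPhase : IsPrimitiveRoot (pauliPhase d) (phaseOrder d) := by
  unfold pauliPhase phaseOrder
  split_ifs
  · exact Complex.isPrimitiveRoot_I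
  · exact Complex.isPrimitiveRoot_exp d (Fact.out : d.Prime).ne_zero

theorem dvd_phaseOrder : d ∣ phaseOrder d := by
  unfold phaseOrder
  split_ifs with h
  · subst h; norm_num
  · exact dvd_rfl

theorem dvd_choose_phaseOrder : d ∣ (phaseOrder d).choose 2 := by
  unfold phaseOrder
  split_ifs with h
  · subst h; decide
  · exact (Fact.out : d.Prime).dvd_choose_self two_ne_zero
      (lt_of_le_of_ne (Fact.out : d.Prime).two_le (Ne.symm h))

theorem pauliGates_subset {P : Gate d} (hP : P ∈ pauliGates d) : P ∈ projPauli d := by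
  obtain ⟨c, p, q, h⟩ := hP
  exact ⟨p, q, by rw [modCenter_eq_of_coe_eq_smul d h]; simp⟩

theorem pauli_mem_pauliGates (p q : ℕ) : pauliZ d ^ p * pauliX d ^ q ∈ pauliGates d :=
  ⟨0, p, q, by simp⟩

theorem pow_phaseOrder {P : Gate d} (hP : P ∈ pauliGates d) : P ^ phaseOrder d = 1 := by
  obtain ⟨c, p, q, h⟩ := hP
  have h1 : ∀ g : Gate d, g ^ d = 1 → ∀ n, d ∣ n → g ^ n = 1 := by
    rintro g hg _ ⟨m, rfl⟩
    rw [pow_mul, hg, one_pow]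
  have hN := isHeisenberg_projPauli d
  have hcomm := hN.commute_mk _ ((projPauli d).pow_mem pauliX_mem q) _
    ((projPauli d).pow_mem pauliZ_mem p)
  have hword : (pauliZ d ^ p * pauliX d ^ q) ^ phaseOrder d = 1 := by
    rw [mul_pow_eq_of_commute_mk hcomm,
      h1 _ (commutator_pow_eq_one hcomm (hN.pow_mem _ ((projPauli d).pow_mem pauliZ_mem p))) _
        dvd_choose_phaseOrder, ← pow_mul, ← pow_mul, mul_comm p, mul_comm q, pow_mul, pow_mul,
      h1 _ (pauliZ_pow_card d) _ dvd_phaseOrder, h1 _ (pauliX_pow_card d) _ dvd_phaseOrder]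
    simp
  apply Subtype.ext
  rw [SubmonoidClass.coe_pow, h, smul_pow, ← pow_mul, mul_comm c, pow_mul,
    isPrimitiveRoot_pauliPhase.pow_eq_one, one_pow, one_smul, ← SubmonoidClass.coe_pow, hword]

theorem exists_eq_center_mul {U : Gate d} (hU : U ∈ projPauli d) :
    ∃ s ∈ Subgroup.center (Gate d), ∃ P ∈ pauliGates d, U = s * P := by
  obtain ⟨i, j, h⟩ := hU
  obtain ⟨p, hp⟩ := exists_pow_eq_zpow d (pauliZ_pow_card d) i
  obtain ⟨q, hq⟩ := exists_pow_eq_zpow d (pauliX_pow_card d) j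
  rw [← map_zpow, ← map_zpow, hp, hq, ← map_mul] at h
  obtain ⟨s, hs, rfl⟩ := mk_eq_mk_iff.1 h
  exact ⟨s, hs, _, pauli_mem_pauliGates p q, rfl⟩

theorem conj_center_mul {Γ : Type*} [Group Γ] {s : Γ} (hs : s ∈ Subgroup.center Γ) (G P : Γ) :
    G * (s * P) * G⁻¹ = s * (G * P * G⁻¹) := by
  rw [← mul_assoc G s, Subgroup.mem_center_iff.1 hs G]
  simp only [mul_assoc]

theorem center_mul_conj {Γ : Type*} [Group Γ] {s : Γ} (hs : s ∈ Subgroup.center Γ) (G P : Γ) :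
    (s * G) * P * (s * G)⁻¹ = G * P * G⁻¹ := by
  have h : (s * G) * P * (s * G)⁻¹ = s * (G * P * G⁻¹) * s⁻¹ := by group
  rw [h, ← Subgroup.mem_center_iff.1 hs, mul_inv_cancel_right]

theorem mem_level_succ_succ {k : ℕ} {G : Gate d} :
    G ∈ level d (k + 2) ↔ ∀ P ∈ pauliGates d, G * P * G⁻¹ ∈ level d (k + 1) := Iff.rfl

/-- The Clifford gates are the normalizer of the Pauli gates with arbitrary scalars: conjugates of
Pauli gates have the same order as Pauli gates, so that no scalars other than the powers of
`pauliPhase d` occur in them. -/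
theorem mem_level_two_iff {G : Gate d} :
    G ∈ level d 2 ↔ ∀ n ∈ projPauli d, G * n * G⁻¹ ∈ projPauli d := by
  rw [show (2 : ℕ) = 0 + 2 from rfl, mem_level_succ_succ]
  constructor
  · intro h n hn
    obtain ⟨s, hs, P, hP, rfl⟩ := exists_eq_center_mul hn
    rw [conj_center_mul hs]
    exact (projPauli d).mul_mem ((isHeisenberg_projPauli d).center_le hs)
      (pauliGates_subset (h P hP))
  · intro h P hP
    obtain ⟨s, hs, P', hP', hPP'⟩ := exists_eq_center_mul (h P (pauliGates_subset hP))
    have hse : s ^ phaseOrder d = 1 := by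
      have hcomm : Commute s P' := (Subgroup.mem_center_iff.1 hs P').symm
      have := congrArg (· ^ phaseOrder d) hPP'
      simp only [conj_pow] at this
      rw [hcomm.mul_pow, pow_phaseOrder hP, pow_phaseOrder hP'] at this
      simpa using this.symm
    obtain ⟨e, he⟩ := (mem_center_iff_exists_smul d).1 hs
    have hee : e ^ phaseOrder d = 1 := by
      have := congrArg Subtype.val hse
      rw [SubmonoidClass.coe_pow, he, smul_pow, one_pow] at this
      simpa using congrFun₂ this 0 0
    have : NeZero (phaseOrder d) := ⟨by
      unfold phaseOrder
      split_ifs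
      · norm_num
      · exact (Fact.out : d.Prime).ne_zero⟩
    obtain ⟨m, -, rfl⟩ := isPrimitiveRoot_pauliPhase.eq_pow_of_pow_eq_one hee
    obtain ⟨c, p, q, hc⟩ := hP'
    rw [hPP']
    refine ⟨m + c, p, q, ?_⟩
    rw [Submonoid.coe_mul, he, hc, smul_mul_assoc, one_mul, smul_smul, pow_add]

theorem center_mul_mem_level {k : ℕ} {s G : Gate d} (hs : s ∈ Subgroup.center (Gate d))
    (hG : G ∈ level d (k + 2)) : s * G ∈ level d (k + 2) := by
  rw [mem_level_succ_succ] at hG ⊢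
  intro P hP
  rw [center_mul_conj hs]
  exact hG P hP

theorem conj_mem_level {k : ℕ} {G n : Gate d} (hG : G ∈ level d (k + 3)) (hn : n ∈ projPauli d) :
    G * n * G⁻¹ ∈ level d (k + 2) := by
  obtain ⟨s, hs, P, hP, rfl⟩ := exists_eq_center_mul hn
  rw [conj_center_mul hs]
  exact center_mul_mem_level hs (hG P hP)

theorem projPauli_subset_level_two {G : Gate d} (hG : G ∈ projPauli d) : G ∈ level d 2 :=
  mem_level_two_iff.2 fun _ hn =>
    (projPauli d).mul_mem ((projPauli d).mul_mem hG hn) ((projPauli d).inv_mem hG)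

theorem level_subset_succ (k : ℕ) : level d (k + 1) ⊆ level d (k + 2) := by
  induction k with
  | zero => exact fun G hG => projPauli_subset_level_two (pauliGates_subset hG)
  | succ k ih => exact fun G hG P hP => ih (hG P hP)

theorem level_two_subset (k : ℕ) : level d 2 ⊆ level d (k + 2) := by
  induction k with
  | zero => exact subset_rfl
  | succ k ih => exact ih.trans (level_subset_succ (k + 1))

/-- A gate is Clifford if it conjugates two non-commuting Pauli gates to Pauli gates. -/
theorem mem_level_two_of_pauli {G : Gate d} {a b : Gate d} (ha : a ∈ projPauli d)
    (hb : b ∈ projPauli d) (hab : ¬ Commute a b) (hGa : G * a * G⁻¹ ∈ projPauli d)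
    (hGb : G * b * G⁻¹ ∈ projPauli d) : G ∈ level d 2 :=
  mem_level_two_iff.2 fun _ hn => (isHeisenberg_projPauli d).conj_mem ha hb hab hGa hGb hn

theorem mul_mem_level_two {G C : Gate d} (hG : G ∈ level d 2) (hC : C ∈ level d 2) :
    G * C ∈ level d 2 := by
  rw [mem_level_two_iff] at *
  intro n hn
  have := hG _ (hC n hn)
  convert this using 1
  group

theorem inv_mem_level_two {G : Gate d} (hG : G ∈ level d 2) : G⁻¹ ∈ level d 2 := by
  rw [mem_level_two_iff] at *
  intro n hn
  rw [inv_inv]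
  exact (isHeisenberg_projPauli d).conj_inv_mem pauliZ_mem pauliX_mem not_commute_pauliZ_pauliX
    (hG _ pauliZ_mem) (hG _ pauliX_mem) hn

theorem pow_mem_level_two {G : Gate d} (hG : G ∈ level d 2) (n : ℕ) : G ^ n ∈ level d 2 := by
  induction n with
  | zero => exact projPauli_subset_level_two (projPauli d).one_mem
  | succ n ih => rw [pow_succ]; exact mul_mem_level_two ih hG

theorem level_mul_clifford {k : ℕ} {G C : Gate d} (hG : G ∈ level d (k + 2))
    (hC : C ∈ level d 2) : G * C ∈ level d (k + 2) := by
  cases k with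
  | zero => exact mul_mem_level_two hG hC
  | succ k =>
    intro P hP
    have := conj_mem_level hG (mem_level_two_iff.1 hC P (pauliGates_subset hP))
    convert this using 1
    group

theorem clifford_mul_level {k : ℕ} {G C : Gate d} (hC : C ∈ level d 2)
    (hG : G ∈ level d (k + 2)) : C * G ∈ level d (k + 2) := by
  induction k generalizing G with
  | zero => exact mul_mem_level_two hC hG
  | succ k ih =>
    intro P hP
    have := level_mul_clifford (ih (hG P hP)) (inv_mem_level_two hC)
    convert this using 1
    group

/-- Every gate of the hierarchy is semi-Clifford: it conjugates some nontrivial Pauli gate to a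
Pauli gate. -/
theorem exists_pauli_conj_mem (k : ℕ) {G : Gate d} (hG : G ∈ level d (k + 2)) :
    ∃ u ∈ projPauli d, u ∉ Subgroup.center (Gate d) ∧ G * u * G⁻¹ ∈ projPauli d := by
  induction k generalizing G with
  | zero =>
    refine ⟨pauliZ d, pauliZ_mem, ?_, mem_level_two_iff.1 hG _ pauliZ_mem⟩
    exact fun h => not_commute_pauliZ_pauliX (Subgroup.mem_center_iff.1 h (pauliX d)).symm
  | succ k ih =>
    exact (isHeisenberg_projPauli d).exists_conj_mem fun n hn => ih (conj_mem_level hG hn)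

end Levels

/-! ### Some Clifford gates -/

section CliffordGates

variable {d : ℕ} [Fact d.Prime]

theorem hadamard_mul_pauliX : hadamard d * pauliX d = pauliZ d * hadamard d := by
  apply Subtype.ext
  ext i j
  rw [Submonoid.coe_mul, Submonoid.coe_mul, mul_pauliX_apply, pauliZ, Matrix.diagonal_mul]
  simp only [hadamard, Matrix.of_apply]
  rw [mul_add, mul_one, AddChar.map_add_eq_mul]
  ring

theorem pauliX_mul_hadamard_mul_pauliZ : pauliX d * (hadamard d * pauliZ d) = hadamard d := by
  apply Subtype.ext
  ext i j
  rw [Submonoid.coe_mul, Submonoid.coe_mul, pauliX_mul_apply, pauliZ, Matrix.mul_diagonal]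
  simp only [hadamard, Matrix.of_apply]
  rw [mul_assoc, ← AddChar.map_add_eq_mul]
  congr 2
  ring

theorem hadamard_conj_pauliZ : hadamard d * pauliZ d * (hadamard d)⁻¹ = (pauliX d)⁻¹ := by
  rw [mul_inv_eq_iff_eq_mul, eq_inv_mul_iff_mul_eq]
  exact pauliX_mul_hadamard_mul_pauliZ

theorem hadamard_mem_level_two : hadamard d ∈ level d 2 := by
  refine mem_level_two_of_pauli pauliZ_mem pauliX_mem not_commute_pauliZ_pauliX ?_ ?_
  · rw [hadamard_conj_pauliZ]
    exact (projPauli d).inv_mem pauliX_mem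
  · rw [hadamard_mul_pauliX, mul_inv_cancel_right]
    exact pauliZ_mem

variable (d) in
/-- The exponent `κ` for which `E X E⁻¹` is proportional to `Z ^ κ X`. -/
def shearExponent : ℕ := if d = 2 then 1 else 2

theorem shearExponent_ne_zero : ((shearExponent d : ℕ) : ZMod d) ≠ 0 := by
  rw [Ne, ZMod.natCast_eq_zero_iff]
  unfold shearExponent
  split_ifs with h
  · subst h; norm_num
  · exact fun h2 => h ((Nat.prime_dvd_prime_iff_eq Fact.out Nat.prime_two).1 h2)

theorem commute_gateE_pauliZ : Commute (gateE d) (pauliZ d) :=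
  commute_pauliZ_of_isDiag d (Matrix.isDiag_diagonal _)

theorem eq_zero_or_eq_one_of_zmod_two : ∀ j : ZMod 2, j = 0 ∨ j = 1 := by decide

theorem modCenter_gateE_conj_pauliX : modCenter (gateE d * pauliX d * (gateE d)⁻¹) =
    modCenter (pauliZ d) ^ (shearExponent d : ℤ) * modCenter (pauliX d) := by
  have h : ∃ c : ℂ, ((gateE d * pauliX d : Gate d) : Matrix (ZMod d) (ZMod d) ℂ) =
      c • ((pauliZ d ^ shearExponent d * pauliX d * gateE d : Gate d) :
        Matrix (ZMod d) (ZMod d) ℂ) := by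
    refine ⟨if d = 2 then -Complex.I else ZMod.stdAddChar (-1 : ZMod d), ?_⟩
    ext i j
    have hE : (gateE d : Matrix (ZMod d) (ZMod d) ℂ) = Matrix.diagonal fun z =>
      if d = 2 then Complex.I ^ z.val else ZMod.stdAddChar (z ^ 2) := rfl
    rw [Submonoid.coe_mul, Submonoid.coe_mul, Submonoid.coe_mul, mul_pauliX_apply, hE,
      Matrix.smul_apply, Matrix.mul_diagonal, mul_pauliX_apply, pauliZ_pow, Matrix.diagonal_apply,
      Matrix.diagonal_apply]
    by_cases hij : i = j + 1
    · subst hij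
      by_cases h2 : d = 2
      · subst h2
        have h1 : (ZMod.stdAddChar (1 : ZMod 2) : ℂ) = -1 := by
          have := ZMod.stdAddChar_coe (N := 2) 1
          rw [Int.cast_one] at this
          rw [this, ← Complex.exp_pi_mul_I]
          congr 1
          push_cast
          ring
        have h11 : (1 + 1 : ZMod 2) = 0 := rfl
        have hv : (1 : ZMod 2).val = 1 := rfl
        rcases eq_zero_or_eq_one_of_zmod_two j with rfl | rfl
        · simp [shearExponent, h1, hv]
        · simp [shearExponent, h11, hv]
      · simp only [h2, if_false, if_true, shearExponent, smul_eq_mul]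
        rw [← AddChar.map_add_eq_mul, ← AddChar.map_add_eq_mul]
        congr 1
        push_cast
        ring
    · simp [hij]
  obtain ⟨c, hc⟩ := h
  have := modCenter_eq_of_coe_eq_smul d hc
  rw [map_mul, map_inv, this]
  simp

theorem gateE_mem_level_two : gateE d ∈ level d 2 := by
  refine mem_level_two_of_pauli pauliZ_mem pauliX_mem not_commute_pauliZ_pauliX ?_ ?_
  · rw [commute_gateE_pauliZ.eq, mul_inv_cancel_right]
    exact pauliZ_mem
  · exact ⟨shearExponent d, 1, by rw [modCenter_gateE_conj_pauliX, zpow_one]⟩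

theorem gatesM_subset_level_two {M : Gate d} (hM : M ∈ gatesM d) : M ∈ level d 2 := by
  rcases hM with rfl | ⟨c, -, rfl⟩
  · exact projPauli_subset_level_two (projPauli d).one_mem
  · exact mul_mem_level_two (pow_mem_level_two gateE_mem_level_two c) hadamard_mem_level_two

theorem modCenter_gateE_pow_conj_pauliX (c : ℕ) :
    modCenter (gateE d ^ c * pauliX d * (gateE d ^ c)⁻¹) =
      modCenter (pauliZ d) ^ (shearExponent d * c : ℤ) * modCenter (pauliX d) := by
  induction c with
  | zero => simp
  | succ c ih =>
    have h1 : gateE d ^ (c + 1) * pauliX d * (gateE d ^ (c + 1))⁻¹ =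
        gateE d * (gateE d ^ c * pauliX d * (gateE d ^ c)⁻¹) * (gateE d)⁻¹ := by
      rw [pow_succ']; group
    have hE := (commute_gateE_pauliZ (d := d)).map modCenter
    have h2 := modCenter_gateE_conj_pauliX (d := d)
    rw [map_mul, map_mul, map_inv] at h2
    rw [h1, map_mul, map_mul, ih, ← mul_assoc, (hE.zpow_right _).eq, map_inv,
      mul_assoc (_ ^ _), mul_assoc (_ ^ _), h2, ← mul_assoc, ← _root_.zpow_add]
    congr 2

theorem modCenter_conj_pauliZ (c : ℕ) :
    modCenter ((gateE d ^ c * hadamard d) * pauliZ d * (gateE d ^ c * hadamard d)⁻¹) =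
      modCenter (pauliZ d) ^ (-(shearExponent d * c) : ℤ) * modCenter (pauliX d) ^ (-1 : ℤ) := by
  have h : (gateE d ^ c * hadamard d) * pauliZ d * (gateE d ^ c * hadamard d)⁻¹ =
      (gateE d ^ c * pauliX d * (gateE d ^ c)⁻¹)⁻¹ := by
    calc _ = gateE d ^ c * (hadamard d * pauliZ d * (hadamard d)⁻¹) * (gateE d ^ c)⁻¹ := by group
      _ = _ := by rw [hadamard_conj_pauliZ]; group
  rw [h, map_inv, modCenter_gateE_pow_conj_pauliX, _root_.zpow_neg, _root_.zpow_neg_one]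
  exact ((commute_mk_pauli d).zpow_left _).mul_inv

/-- The gates `M ∈ ℳ` are separated by the lines spanned by `M Z M⁻¹`. -/
theorem eq_of_commute_conj {M M' : Gate d} (hM : M ∈ gatesM d) (hM' : M' ∈ gatesM d)
    (h : Commute (M * pauliZ d * M⁻¹) (M' * pauliZ d * M'⁻¹)) : M = M' := by
  have h1 : modCenter ((1 : Gate d) * pauliZ d * (1 : Gate d)⁻¹) =
      modCenter (pauliZ d) ^ (1 : ℤ) * modCenter (pauliX d) ^ (0 : ℤ) := by simp
  rcases hM with rfl | ⟨c, hc, rfl⟩ <;> rcases hM' with rfl | ⟨c', hc', rfl⟩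
  · rfl
  · rw [commute_iff_cast_eq_zero h1 (modCenter_conj_pauliZ c')] at h
    simp at h
  · rw [commute_iff_cast_eq_zero (modCenter_conj_pauliZ c) h1] at h
    simp at h
  · rw [commute_iff_cast_eq_zero (modCenter_conj_pauliZ c) (modCenter_conj_pauliZ c')] at h
    push_cast at h
    have h' : ((shearExponent d : ℕ) : ZMod d) * ((c : ZMod d) - c') = 0 := by linear_combination h
    have h2 := sub_eq_zero.1 ((mul_eq_zero.1 h').resolve_left shearExponent_ne_zero)
    rw [ZMod.natCast_eq_natCast_iff', Nat.mod_eq_of_lt hc, Nat.mod_eq_of_lt hc'] at h2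
    rw [h2]

theorem modCenter_pauliZ_pow_card : modCenter (pauliZ d) ^ d = 1 := by
  rw [← map_pow, pauliZ_pow_card, map_one]

theorem modCenter_pauliX_pow_card : modCenter (pauliX d) ^ d = 1 := by
  rw [← map_pow, pauliX_pow_card, map_one]

/-- The lines spanned by the `M Z M⁻¹`, `M ∈ ℳ`, cover all Pauli gates. -/
theorem exists_gatesM_conj {Q : Gate d} (hQ : Q ∈ projPauli d) :
    ∃ M ∈ gatesM d, ∃ i : ℤ, modCenter Q = modCenter (M * pauliZ d ^ i * M⁻¹) := by
  obtain ⟨a, b, h⟩ := hQ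
  by_cases hb : (b : ZMod d) = 0
  · refine ⟨1, Or.inl rfl, a, ?_⟩
    rw [h, zpow_eq_zpow_of_cast_eq modCenter_pauliX_pow_card (n := 0) (by simpa using hb)]
    simp
  · let t : ZMod d := a * ((shearExponent d : ℕ) * b : ZMod d)⁻¹
    refine ⟨gateE d ^ t.val * hadamard d, Or.inr ⟨t.val, ZMod.val_lt t, rfl⟩, -b, ?_⟩
    rw [← conj_zpow, map_zpow, modCenter_conj_pauliZ,
      ((commute_mk_pauli d).zpow_zpow _ _).mul_zpow, ← _root_.zpow_mul, ← _root_.zpow_mul, h]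
    congr 1
    · apply zpow_eq_zpow_of_cast_eq modCenter_pauliZ_pow_card
      push_cast
      rw [ZMod.natCast_zmod_val]
      have hs := shearExponent_ne_zero (d := d)
      simp only [t]
      field_simp
    · congr 1
      ring

theorem mulGate_mem_unitary (m : (ZMod d)ˣ) :
    (Matrix.of fun i j : ZMod d => if i = m * j then (1 : ℂ) else 0) ∈
      Matrix.unitaryGroup (ZMod d) ℂ := by
  rw [Matrix.mem_unitaryGroup_iff']
  ext i j
  simp [Matrix.mul_apply, Matrix.star_apply, Matrix.one_apply, eq_comm]

/-- The gate `|z⟩ ↦ |m z⟩` for an invertible scalar `m` modulo `d`. -/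
def mulGate (m : (ZMod d)ˣ) : Gate d :=
  ⟨Matrix.of fun i j => if i = m * j then 1 else 0, mulGate_mem_unitary m⟩

theorem mulGate_apply (m : (ZMod d)ˣ) (i j : ZMod d) :
    (mulGate m : Matrix (ZMod d) (ZMod d) ℂ) i j = if i = m * j then 1 else 0 := rfl

theorem pauliZ_mul_mulGate (m : (ZMod d)ˣ) :
    pauliZ d * mulGate m = mulGate m * pauliZ d ^ (m : ZMod d).val := by
  apply Subtype.ext
  rw [Submonoid.coe_mul, Submonoid.coe_mul, pauliZ_pow, pauliZ]
  ext i j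
  rw [Matrix.diagonal_mul, Matrix.mul_diagonal, mulGate_apply, ZMod.natCast_zmod_val]
  by_cases h : i = m * j
  · simp [h]
  · simp [h]

theorem mulGate_mul_pauliX (m : (ZMod d)ˣ) :
    mulGate m * pauliX d = pauliX d ^ (m : ZMod d).val * mulGate m := by
  apply Subtype.ext
  ext i j
  rw [Submonoid.coe_mul, Submonoid.coe_mul, mul_pauliX_apply, mulGate_apply, Matrix.mul_apply]
  simp only [pauliX_pow_apply, mulGate_apply, ZMod.natCast_zmod_val]
  rw [Finset.sum_eq_single (m * j : ZMod d)]
  · simp [mul_add]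
  · intro b _ hb
    simp [hb]
  · simp

theorem mulGate_mem_level_two (m : (ZMod d)ˣ) : mulGate m ∈ level d 2 := by
  have hZ : mulGate m * pauliZ d ^ (m : ZMod d).val * (mulGate m)⁻¹ = pauliZ d := by
    rw [← pauliZ_mul_mulGate, mul_inv_cancel_right]
  have hX : mulGate m * pauliX d * (mulGate m)⁻¹ = pauliX d ^ (m : ZMod d).val := by
    rw [mulGate_mul_pauliX, mul_inv_cancel_right]
  refine mem_level_two_of_pauli ((projPauli d).pow_mem pauliZ_mem (m : ZMod d).val) pauliX_mem ?_
    (by rw [hZ]; exact pauliZ_mem) (by rw [hX]; exact (projPauli d).pow_mem pauliX_mem _)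
  rw [commute_iff_cast_eq_zero (i := ((m : ZMod d).val : ℤ)) (j := 0) (k := 0) (l := 1)
    (by rw [map_pow, zpow_natCast, zpow_zero, mul_one]) (by simp)]
  simp

end CliffordGates

/-! ### The normal form -/

section NormalForm

variable {d : ℕ} [Fact d.Prime]

theorem isDiag_mul {D D' : Gate d} (hD : (D : Matrix (ZMod d) (ZMod d) ℂ).IsDiag)
    (hD' : (D' : Matrix (ZMod d) (ZMod d) ℂ).IsDiag) :
    ((D * D' : Gate d) : Matrix (ZMod d) (ZMod d) ℂ).IsDiag :=
  isDiag_of_commute_pauliZ d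
    ((commute_pauliZ_of_isDiag d hD).mul_left (commute_pauliZ_of_isDiag d hD'))

theorem isDiag_inv {D : Gate d} (hD : (D : Matrix (ZMod d) (ZMod d) ℂ).IsDiag) :
    ((D⁻¹ : Gate d) : Matrix (ZMod d) (ZMod d) ℂ).IsDiag :=
  isDiag_of_commute_pauliZ d (commute_pauliZ_of_isDiag d hD).inv_left

theorem mul_apply_of_isDiag {D D' : Gate d} (hD : (D : Matrix (ZMod d) (ZMod d) ℂ).IsDiag)
    (z : ZMod d) : ((D * D' : Gate d) : Matrix (ZMod d) (ZMod d) ℂ) z z =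
      (D : Matrix (ZMod d) (ZMod d) ℂ) z z * (D' : Matrix (ZMod d) (ZMod d) ℂ) z z := by
  rw [Submonoid.coe_mul]
  conv_lhs => rw [← hD.diagonal_diag, Matrix.diagonal_mul]
  rfl

theorem inv_apply_self (D : Gate d) (z : ZMod d) :
    ((D⁻¹ : Gate d) : Matrix (ZMod d) (ZMod d) ℂ) z z =
    star ((D : Matrix (ZMod d) (ZMod d) ℂ) z z) := rfl

theorem inv_mul_mem_diagLevel {k : ℕ} {D D' : Gate d}
    (hD : (D : Matrix (ZMod d) (ZMod d) ℂ).IsDiag) (hD0 : (D : Matrix (ZMod d) (ZMod d) ℂ) 0 0 = 1)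
    (hD' : (D' : Matrix (ZMod d) (ZMod d) ℂ).IsDiag)
    (hD0' : (D' : Matrix (ZMod d) (ZMod d) ℂ) 0 0 = 1) (h : D⁻¹ * D' ∈ level d k) :
    D⁻¹ * D' ∈ diagLevel d k := by
  refine ⟨h, isDiag_mul (isDiag_inv hD) hD', ?_⟩
  rw [mul_apply_of_isDiag (isDiag_inv hD), inv_apply_self, hD0, hD0']
  simp

/-- A diagonal gate can be normalized to fix `|0⟩` by a scalar. -/
theorem exists_center_mul_eq {D : Gate d} (hD : (D : Matrix (ZMod d) (ZMod d) ℂ).IsDiag) :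
    ∃ s ∈ Subgroup.center (Gate d), ∃ D' : Gate d, D = s * D' ∧
      (D' : Matrix (ZMod d) (ZMod d) ℂ).IsDiag ∧ (D' : Matrix (ZMod d) (ZMod d) ℂ) 0 0 = 1 := by
  have hc : (D : Matrix (ZMod d) (ZMod d) ℂ) 0 0 *
      star ((D : Matrix (ZMod d) (ZMod d) ℂ) 0 0) = 1 := by
    rw [← inv_apply_self, ← mul_apply_of_isDiag hD, mul_inv_cancel]
    simp
  let s : Gate d := ⟨Matrix.diagonal fun _ => (D : Matrix (ZMod d) (ZMod d) ℂ) 0 0,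
    diagonal_mem_unitary d _ fun _ => hc⟩
  have hs : (s : Matrix (ZMod d) (ZMod d) ℂ).IsDiag := Matrix.isDiag_diagonal _
  have hs0 : (s : Matrix (ZMod d) (ZMod d) ℂ) 0 0 = (D : Matrix (ZMod d) (ZMod d) ℂ) 0 0 :=
    Matrix.diagonal_apply_eq _ _
  refine ⟨s, mem_center_of_coe_eq d (Matrix.smul_one_eq_diagonal _).symm, s⁻¹ * D, by group,
    isDiag_mul (isDiag_inv hs) hD, ?_⟩
  rw [mul_apply_of_isDiag (isDiag_inv hs), inv_apply_self, hs0, mul_comm, hc]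

theorem commute_mk_zpow_of_conj {Γ : Type*} [Group Γ] {G M M' A u z : Γ} {i j : ℤ}
    (hi : modCenter (G * u * G⁻¹) = modCenter (M * z ^ i * M⁻¹))
    (hj : modCenter u = modCenter (M' * z ^ j * M'⁻¹)) (hA : A⁻¹ * z ^ i * A = z ^ j) :
    Commute (modCenter (M⁻¹ * G * M' * A⁻¹)) (modCenter z ^ i) := by
  have h : modCenter (M⁻¹ * G * M' * A⁻¹ * z ^ i * (M⁻¹ * G * M' * A⁻¹)⁻¹) =
      modCenter (z ^ i) := by
    calc modCenter (M⁻¹ * G * M' * A⁻¹ * z ^ i * (M⁻¹ * G * M' * A⁻¹)⁻¹)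
        = modCenter (M⁻¹ * G) * modCenter (M' * (A⁻¹ * z ^ i * A) * M'⁻¹) *
            modCenter (G⁻¹ * M) := by
          rw [← map_mul, ← map_mul]; congr 1; group
      _ = modCenter M⁻¹ * modCenter (G * u * G⁻¹) * modCenter M := by
          rw [hA, ← hj, ← map_mul, ← map_mul, ← map_mul, ← map_mul]; congr 1; group
      _ = modCenter (z ^ i) := by
          rw [hi, ← map_mul, ← map_mul]; congr 1; group
  rw [map_mul, map_mul, map_inv, mul_inv_eq_iff_eq_mul, map_zpow] at h
  exact h

/-- Nontrivial powers of `Z` are conjugate by Clifford gates. -/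
theorem exists_clifford_conj_zpow {i j : ℤ} (hi : (i : ZMod d) ≠ 0) (hj : (j : ZMod d) ≠ 0) :
    ∃ A ∈ level d 2, A⁻¹ * pauliZ d ^ i * A = pauliZ d ^ j := by
  let m : (ZMod d)ˣ := Units.mk0 ((j : ZMod d) * (i : ZMod d)⁻¹) (mul_ne_zero hj (inv_ne_zero hi))
  refine ⟨mulGate m, mulGate_mem_level_two m, ?_⟩
  have h1 : (mulGate m)⁻¹ * pauliZ d * (mulGate m)⁻¹⁻¹ = pauliZ d ^ (m : ZMod d).val := by
    rw [inv_inv, mul_assoc, pauliZ_mul_mulGate, inv_mul_cancel_left]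
  have h2 := conj_zpow (i := i) (a := (mulGate m)⁻¹) (b := pauliZ d)
  rw [h1, inv_inv] at h2
  rw [← h2, ← zpow_natCast, ← _root_.zpow_mul]
  apply zpow_eq_zpow_of_cast_eq (pauliZ_pow_card d)
  push_cast
  rw [ZMod.natCast_zmod_val]
  exact inv_mul_cancel_right₀ hi _

/-- A gate commuting with `Z` up to a scalar becomes diagonal after multiplication by a power of
`X`. -/
theorem exists_commute_mul_zpow {D : Gate d}
    (hD : Commute (modCenter D) (modCenter (pauliZ d))) :
    ∃ b : ℤ, Commute (D * pauliX d ^ (-b)) (pauliZ d) := by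
  have hN := isHeisenberg_projPauli d
  have hXZ := (commute_mk_pauli d).symm
  obtain ⟨b, hb⟩ := hN.exists_zpow_eq ⁅pauliX d, pauliZ d⁆ (commute_mk_iff.1 hXZ)
    ⁅D, pauliZ d⁆ (commute_mk_iff.1 hD)
    (commutator_pow_eq_one hXZ (hN.pow_mem _ pauliZ_mem))
    (commutator_pow_eq_one hD (hN.pow_mem _ pauliZ_mem))
    (fun h => not_commute_pauliZ_pauliX (commutatorElement_eq_one_iff_commute.1 h).symm)
  refine ⟨b, ?_⟩
  rw [← commutatorElement_eq_one_iff_commute, commutator_mul_left,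
    commutator_zpow_left hXZ, ← hb, ← _root_.zpow_add, add_neg_cancel, zpow_zero]
  rw [map_zpow]
  exact hXZ.zpow_left _

theorem cast_ne_zero_of_conj {Q M : Gate d} {i : ℤ} (hQ : Q ∉ Subgroup.center (Gate d))
    (h : modCenter Q = modCenter (M * pauliZ d ^ i * M⁻¹)) : (i : ZMod d) ≠ 0 := by
  intro h0
  rw [zpow_eq_zpow_of_cast_eq (pauliZ_pow_card d) (n := 0) (by simpa using h0)] at h
  exact hQ (mk_eq_one_iff.1 (by rw [h, zpow_zero, mul_one, mul_inv_cancel, map_one]))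

/-- Existence of the normal form, up to the choice of `D` in its coset. -/
theorem exists_eq_mul_diag_mul_clifford {k : ℕ} {G : Gate d} (hG : G ∈ level d (k + 2)) :
    ∃ M ∈ gatesM d, ∃ D : Gate d, ∃ C ∈ level d 2, G = M * D * C ∧
      (D : Matrix (ZMod d) (ZMod d) ℂ).IsDiag ∧ (D : Matrix (ZMod d) (ZMod d) ℂ) 0 0 = 1 := by
  obtain ⟨u, hu, huS, huG⟩ := exists_pauli_conj_mem k hG
  obtain ⟨M, hM, i, hi⟩ := exists_gatesM_conj huG
  obtain ⟨M', hM', j, hj⟩ := exists_gatesM_conj hu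
  have hi0 := cast_ne_zero_of_conj (not_mem_center_conj huS) hi
  -- `M⁻¹ G M'` conjugates `Z ^ j` to `Z ^ i` up to a scalar. The Clifford gate `A` corrects the
  -- exponent, and a power of `X` corrects the scalar.
  obtain ⟨A, hA, hAZ⟩ := exists_clifford_conj_zpow hi0 (cast_ne_zero_of_conj huS hj)
  have hcomm : Commute (modCenter (M⁻¹ * G * M' * A⁻¹)) (modCenter (pauliZ d)) := by
    obtain ⟨r, hr⟩ := exists_zpow_zpow_eq modCenter_pauliZ_pow_card hi0
    have h := (commute_mk_zpow_of_conj hi hj hAZ).zpow_right r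
    rwa [hr] at h
  obtain ⟨b, hb⟩ := exists_commute_mul_zpow hcomm
  obtain ⟨s, hs, D, hsD, hDdiag, hD0⟩ := exists_center_mul_eq (isDiag_of_commute_pauliZ d hb)
  have hs2 := projPauli_subset_level_two ((isHeisenberg_projPauli d).center_le hs)
  have hX2 := projPauli_subset_level_two ((projPauli d).zpow_mem pauliX_mem b)
  refine ⟨M, hM, D, s * (pauliX d ^ b * A * M'⁻¹), mul_mem_level_two hs2 (mul_mem_level_two
    (mul_mem_level_two hX2 hA) (inv_mem_level_two (gatesM_subset_level_two hM'))), ?_, hDdiag, hD0⟩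
  calc G = M * (M⁻¹ * G * M' * A⁻¹ * pauliX d ^ (-b)) * (pauliX d ^ b * A * M'⁻¹) := by group
    _ = M * D * (s * (pauliX d ^ b * A * M'⁻¹)) := by
        rw [hsD, ← Subgroup.mem_center_iff.1 hs D]
        simp only [mul_assoc]

/-- For `D` diagonal and `C` Clifford, `G = M D C` conjugates the Pauli gate `C⁻¹ Z C` to `M Z M⁻¹`.
If `M` were not determined by `G`, then `G⁻¹` would conjugate two non-commuting Pauli gates to Pauli
gates. -/
theorem eq_of_mul_diag_mul_clifford_eq {M D C M' D' C' : Gate d}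
    (hM : M ∈ gatesM d) (hM' : M' ∈ gatesM d) (hD : (D : Matrix (ZMod d) (ZMod d) ℂ).IsDiag)
    (hD' : (D' : Matrix (ZMod d) (ZMod d) ℂ).IsDiag) (hC : C ∈ level d 2) (hC' : C' ∈ level d 2)
    (hG : M * D * C ∉ level d 2) (h : M * D * C = M' * D' * C') : M = M' := by
  have key : ∀ M D C : Gate d, (D : Matrix (ZMod d) (ZMod d) ℂ).IsDiag → C ∈ level d 2 →
      (M * D * C)⁻¹ * (M * pauliZ d * M⁻¹) * (M * D * C)⁻¹⁻¹ ∈ projPauli d := by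
    intro M D C hD hC
    have h1 := (commute_pauliZ_of_isDiag d hD).eq
    have h2 := mem_level_two_iff.1 (inv_mem_level_two hC) _ pauliZ_mem
    convert h2 using 1
    calc _ = C⁻¹ * D⁻¹ * (pauliZ d * D) * C := by group
      _ = C⁻¹ * pauliZ d * C⁻¹⁻¹ := by rw [← h1]; group
  have hmem : ∀ M ∈ gatesM d, M * pauliZ d * M⁻¹ ∈ projPauli d := fun M hM =>
    mem_level_two_iff.1 (gatesM_subset_level_two hM) _ pauliZ_mem
  by_contra hne
  have hnc : ¬ Commute (M * pauliZ d * M⁻¹) (M' * pauliZ d * M'⁻¹) := fun hc =>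
    hne (eq_of_commute_conj hM hM' hc)
  have h3 := key M' D' C' hD' hC'
  rw [← h] at h3
  have h4 := inv_mem_level_two
    (mem_level_two_of_pauli (hmem M hM) (hmem M' hM') hnc (key M D C hD hC) h3)
  rw [inv_inv] at h4
  exact hG h4

theorem not_mem_level_two_of_mem_representatives {k : ℕ} {R : Set (Gate d)}
    (hR : IsCosetRepresentatives d k R) (hR1 : (1 : Gate d) ∈ R) {D : Gate d} (hD : D ∈ R \ {1}) :
    D ∉ level d 2 := by
  intro h
  obtain ⟨hDk, hdiag, hD0⟩ := hR.1 hD.1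
  have h1 : ((1 : Gate d) : Matrix (ZMod d) (ZMod d) ℂ).IsDiag := Matrix.isDiag_one
  have h10 : ((1 : Gate d) : Matrix (ZMod d) (ZMod d) ℂ) 0 0 = 1 := by simp
  apply hD.2
  refine (hR.2 D (hR.1 hD.1)).unique ⟨hD.1, ?_⟩ ⟨hR1, ?_⟩
  · apply inv_mul_mem_diagLevel hdiag hD0 hdiag hD0
    rw [inv_mul_cancel]
    exact projPauli_subset_level_two (projPauli d).one_mem
  · apply inv_mul_mem_diagLevel h1 h10 hdiag hD0
    rwa [inv_one, one_mul]

theorem mem_level_two_of_mul_mem {M D C : Gate d} (hM : M ∈ level d 2) (hC : C ∈ level d 2)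
    (h : M * D * C ∈ level d 2) : D ∈ level d 2 := by
  have := mul_mem_level_two (mul_mem_level_two (inv_mem_level_two hM) h) (inv_mem_level_two hC)
  convert this using 1
  group

end NormalForm

end CliffordHierarchy

end

open CliffordHierarchy in
theorem mainTheorem3 (d : ℕ) [Fact d.Prime] (k : ℕ) (hk : 2 ≤ k)
    (R : Set (Gate d)) (hR : IsCosetRepresentatives d k R) (hR1 : (1 : Gate d) ∈ R) :
    (∀ G ∈ level d k, G ∉ level d 2 →
      ∃! t : Gate d × Gate d × Gate d,
        t.1 ∈ gatesM d ∧ t.2.1 ∈ R \ {1} ∧ t.2.2 ∈ level d 2 ∧ G = t.1 * t.2.1 * t.2.2) ∧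
    level d 2 ⊆ level d k ∧
    (∀ M ∈ gatesM d, ∀ D ∈ R \ {1}, ∀ C ∈ level d 2,
      M * D * C ∈ level d k ∧ M * D * C ∉ level d 2) := by
  obtain ⟨k, rfl⟩ := Nat.exists_eq_add_of_le' hk
  refine ⟨?_, level_two_subset k, ?_⟩
  · intro G hG hG2
    obtain ⟨M, hM, D, C, hC, rfl, hD, hD0⟩ := exists_eq_mul_diag_mul_clifford hG
    have hM2 := gatesM_subset_level_two hM
    have hDk : D ∈ diagLevel d (k + 2) := by
      refine ⟨?_, hD, hD0⟩
      have := level_mul_clifford (clifford_mul_level (inv_mem_level_two hM2) hG)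
        (inv_mem_level_two hC)
      convert this using 1
      group
    obtain ⟨r, ⟨hrR, hrD⟩, -⟩ := hR.2 D hDk
    refine ⟨(M, r, r⁻¹ * D * C), ⟨hM, ⟨hrR, ?_⟩, mul_mem_level_two hrD.1 hC, by group⟩, ?_⟩
    · rintro rfl
      rw [inv_one, one_mul] at hrD
      exact hG2 (mul_mem_level_two (mul_mem_level_two hM2 hrD.1) hC)
    · rintro ⟨M', D', C'⟩ ⟨hM', hD', hC', h⟩
      dsimp only at hM' hD' hC' h
      obtain ⟨-, hdiag', hD0'⟩ := hR.1 hD'.1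
      obtain rfl := eq_of_mul_diag_mul_clifford_eq hM hM' hD hdiag' hC hC' hG2 h
      have hDC : D'⁻¹ * D = C' * C⁻¹ := by
        rw [mul_assoc, mul_assoc, mul_right_inj] at h
        rw [eq_mul_inv_iff_mul_eq, mul_assoc, h, inv_mul_cancel_left]
      have hD'2 : D'⁻¹ * D ∈ diagLevel d 2 := by
        apply inv_mul_mem_diagLevel hdiag' hD0' hD hD0
        rw [hDC]
        exact mul_mem_level_two hC' (inv_mem_level_two hC)
      obtain rfl := (hR.2 D hDk).unique ⟨hD'.1, hD'2⟩ ⟨hrR, hrD⟩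
      rw [hDC, inv_mul_cancel_right]
  · intro M hM D hD C hC
    have hM2 := gatesM_subset_level_two hM
    exact ⟨level_mul_clifford (clifford_mul_level hM2 (hR.1 hD.1).1) hC, fun h =>
      not_mem_level_two_of_mem_representatives hR hR1 hD (mem_level_two_of_mul_mem hM2 hC h)⟩
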